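/- Let $p,n\ge 0$ be integers. For a smooth real function $f$ of $x\in\mathbb R^p$ write $\mathrm{pr}^{(n)}f(x)=(\partial^\alpha f(x))_{|\alpha|\le n}$, and let $(x,u^{(n)})=(x,(u_\alpha)_{|\alpha|\le n})$ be the coordinates of the $n$-jet space $\mathbb R^p\times\mathcal U^{(n)}$, where $\mathcal U^{(n)}=\mathbb R^{\{\alpha\in\mathbb N_0^p:\,|\alpha|\le n\}}$ and $u=u_0$. Call a smooth function $\Phi(x,w)$ on $\Omega\times\mathbb R^m$ ($\Omega\subseteq\mathbb R^p$ open) slowly increasing if each of its derivatives of any order, in $(x,w)$, is bounded by a polynomial in $|w|$, uniformly for $x$ in compact subsets of $\Omega$. For open $\Omega\subseteq\mathbb R^p$ let $\mathcal G(\Omega)=\mathcal E_M(\Omega)/\mathcal N(\Omega)$ be the Colombeau algebra: $\mathcal E_M(\Omega)$ (resp. $\mathcal N(\Omega)$) consists of the families $(u_\varepsilon)_{\varepsilon\in(0,1]}$ in $C^\infty(\Omega)$ such that for all compact $K\subset\Omega$ and all $\alpha$ one has $\sup_K|\partial^\alpha u_\varepsilon|=O(\varepsilon^{-N})$ as $\varepsilon\to0$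 for some $N\in\mathbb N$ (resp. $O(\varepsilon^{q})$ for all $q\in\mathbb N$). Let $\Delta:\mathbb R^p\times\mathcal U^{(n)}\to\mathbb R$ be smooth and slowly increasing (with $w=u^{(n)}$). Then $\Delta(\cdot,\mathrm{pr}^{(n)}U)=\mathrm{cl}[(\Delta(\cdot,\mathrm{pr}^{(n)}u_\varepsilon))_\varepsilon]\in\mathcal G(\Omega)$ is well defined for $U=\mathrm{cl}[(u_\varepsilon)_\varepsilon]\in\mathcal G(\Omega)$, and $U$ is called a solution of $$\Delta(x,u^{(n)})=0\tag{1}$$ in $\mathcal G(\Omega)$ if this element is $0$. Let $\eta\mapsto g_\eta$, $g_\eta(x,u)=(\Xi_\eta(x),\Phi_\eta(x,u))$, be a smooth projectable local one-parameter group of transformations of an open set $\mathcal M\subseteq\mathbb R^p\times\mathbb R$. Let it be slowly increasing: for all $\eta$ and all open $\Omega$ such that $g_\eta$ is defined on $\Omega\times\mathbb R$, the function $\Phi_\eta$ is slowly increasing on $\Omega\times\mathbb R$ (with $w=u$). For such $\eta,\Omega$ and $U=\mathrm{cl}[(u_\varepsilon)_\varepsilon]\in\mathcal G(\Omega)$ the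 element $$g_\eta U=\mathrm{cl}\big[\big((\Phi_\eta\circ(\mathrm{id}\times u_\varepsilon))\circ\Xi_\eta^{-1}\big)_\varepsilon\big]\in\mathcal G(\Xi_\eta(\Omega))$$ is well defined. Suppose that $g_\eta$ is a classical symmetry group of (1), in at least one of the following senses: (a) the prolonged group leaves the variety $\{\Delta=0\}$ invariant: $\Delta(z)=0$ implies $\Delta(\mathrm{pr}^{(n)}g_\eta(z))=0$ for every $\eta$ and every $n$-jet $z$ over a point of the domain of $g_\eta$, where $\mathrm{pr}^{(n)}g_\eta$ maps the $n$-jet of $f$ at $x$ to the $n$-jet of $g_\eta f=(\Phi_\eta\circ(\mathrm{id}\times f))\circ\Xi_\eta^{-1}$ at $\Xi_\eta(x)$; or (b) equation (1) is locally solvable over $\mathcal M$ (every $n$-jet over $\mathcal M$ at which $\Delta$ vanishes is the $n$-jet of a smooth solution of (1) on an open set), and, for every $\eta$, $g_\eta$ maps smooth solutions of (1) on open sets, with graph in the domain of $g_\eta$, to smooth solutions of (1). Suppose moreover that for some multi-index $\kappa$ with $|\kappa|\le n$ and some constant $c\ne0$ we have $\partial\Delta/\partial u_\kappa\equiv c$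 on all $n$-jets over $\mathcal M$, that is, $u$ or one of its derivatives occurs in $\Delta$ as an isolated term with constant coefficient. Then $\eta\mapsto g_\eta$ is a symmetry group of (1) in $\mathcal G$: if $U\in\mathcal G(\Omega)$ is a solution of (1) and $g_\eta$ is defined on $\Omega\times\mathbb R$, then $g_\eta U\in\mathcal G(\Xi_\eta(\Omega))$ is a solution of (1). -/

import Mathlib

open Filter Topology TopologicalSpace
open scoped ContDiff

set_option linter.unusedSectionVars false

noncomputable section

namespace GenSymm

/-! ### Growth of families of functions -/

section Growth

variable {E F G H : Type} [NormedAddCommGroup E] [NormedSpace ℝ E]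
  [NormedAddCommGroup F] [NormedSpace ℝ F] [NormedAddCommGroup G] [NormedSpace ℝ G]
  [NormedAddCommGroup H] [NormedSpace ℝ H]

/-- The parameter set `I = (0,1]`. -/
abbrev Par : Type := Set.Ioc (0 : ℝ) 1

/-- The filter `ε → 0` on `I = (0,1]`. -/
def epsZero : Filter Par := Filter.comap (fun ε : Par => (ε : ℝ)) (𝓝 0)

/-- `sup_{x ∈ K} ‖D^k u_ε(x)‖ = O(ε^a)` as `ε → 0`. The norm of the total derivative of order `k`
is equivalent to the maximum of the absolute values of all partial derivatives of order `k`. -/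
def Growth (K : Set E) (k : ℕ) (a : ℤ) (u : Par → E → F) : Prop :=
  (fun q : Par × E => iteratedFDeriv ℝ k (u q.1) q.2) =O[epsZero ×ˢ 𝓟 K]
    (fun q : Par × E => (q.1 : ℝ) ^ a)

/-- Moderate families of smooth functions on the open set `Ω`. The values outside `Ω` play
no role. -/
def IsModerate (Ω : Set E) (u : Par → E → F) : Prop :=
  (∀ ε, ContDiffOn ℝ ∞ (u ε) Ω) ∧
    ∀ K ⊆ Ω, IsCompact K → ∀ k : ℕ, ∃ N : ℕ, Growth K k (-(N : ℤ)) u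

/-- Negligible families of smooth functions on the open set `Ω`. -/
def IsNegligible (Ω : Set E) (u : Par → E → F) : Prop :=
  (∀ ε, ContDiffOn ℝ ∞ (u ε) Ω) ∧
    ∀ K ⊆ Ω, IsCompact K → ∀ k : ℕ, ∀ q : ℕ, Growth K k (q : ℤ) u

/-- A function `Φ(x,w)` that is smooth on `Ω × H` and slowly increasing in `w`, uniformly for `x`
in compact subsets of `Ω`: every derivative is polynomially bounded in `w`, locally uniformly
in `x`. -/
def IsSlowlyIncreasing (Ω : Set E) (Φ : E × H → F) : Prop :=
  ContDiffOn ℝ ∞ Φ (Ω ×ˢ Set.univ) ∧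
    ∀ K ⊆ Ω, IsCompact K → ∀ k : ℕ, ∃ (N : ℕ) (C : ℝ), ∀ x ∈ K, ∀ w : H,
      ‖iteratedFDeriv ℝ k Φ (x, w)‖ ≤ C * (1 + ‖w‖) ^ N

lemma zpow_isBigO {K : Set E} {a b : ℤ} (h : a ≤ b) :
    (fun q : Par × E => (q.1 : ℝ) ^ b) =O[epsZero ×ˢ 𝓟 K] (fun q : Par × E => (q.1 : ℝ) ^ a) := by
  refine Asymptotics.IsBigO.of_bound' (Eventually.of_forall fun q => ?_)
  have h0 : (0 : ℝ) < q.1 := q.1.2.1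
  rw [Real.norm_of_nonneg (by positivity), Real.norm_of_nonneg (by positivity)]
  exact zpow_le_zpow_right_of_le_one₀ h0 q.1.2.2 h

lemma eventually_mem (K : Set E) : ∀ᶠ q : Par × E in epsZero ×ˢ 𝓟 K, q.2 ∈ K :=
  (eventually_principal.2 fun _ hx => hx).prod_inr _

lemma isBigO_of_le {K : Set E} {X Y : Type} [Norm X] [Norm Y] {f : Par × E → X} {g : Par × E → Y}
    (h : ∀ ε, ∀ x ∈ K, ‖f (ε, x)‖ ≤ ‖g (ε, x)‖) : f =O[epsZero ×ˢ 𝓟 K] g :=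
  Asymptotics.IsBigO.of_bound' ((eventually_mem K).mono fun q hq => h q.1 q.2 hq)

lemma Growth.mono {K : Set E} {k : ℕ} {a b : ℤ} {u : Par → E → F} (h : Growth K k b u)
    (hab : a ≤ b) : Growth K k a u :=
  Asymptotics.IsBigO.trans h (zpow_isBigO hab)

lemma IsModerate.upTo {Ω K : Set E} {u : Par → E → F} (h : IsModerate Ω u) (hK : K ⊆ Ω)
    (hKc : IsCompact K) (k : ℕ) : ∃ N : ℕ, ∀ i ≤ k, Growth K i (-(N : ℤ)) u := by
  choose N hN using h.2 K hK hKc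
  refine ⟨∑ i ∈ Finset.range (k + 1), N i, fun i hi => (hN i).mono ?_⟩
  have : N i ≤ ∑ i ∈ Finset.range (k + 1), N i :=
    Finset.single_le_sum (f := N) (fun _ _ => Nat.zero_le _) (Finset.mem_range.2 (by omega))
  omega

lemma Growth.add {Ω K : Set E} (hΩ : IsOpen Ω) (hK : K ⊆ Ω) {k : ℕ} {a : ℤ} {u v : Par → E → F}
    (hu : ∀ ε, ContDiffOn ℝ ∞ (u ε) Ω) (hv : ∀ ε, ContDiffOn ℝ ∞ (v ε) Ω)
    (h : Growth K k a u) (h' : Growth K k a v) : Growth K k a (fun ε x => u ε x + v ε x) := by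
  refine ((Asymptotics.IsBigO.add h h').congr' ?_ EventuallyEq.rfl)
  filter_upwards [eventually_mem K] with q hq
  have hn := hΩ.mem_nhds (hK hq)
  exact (iteratedFDeriv_add_apply (((hu q.1).contDiffAt hn).of_le (mod_cast le_top))
    (((hv q.1).contDiffAt hn).of_le (mod_cast le_top))).symm

lemma Growth.clm {Ω K : Set E} (hΩ : IsOpen Ω) (hK : K ⊆ Ω) {k : ℕ} {a : ℤ} {u : Par → E → F}
    (hu : ∀ ε, ContDiffOn ℝ ∞ (u ε) Ω) (L : F →L[ℝ] G)
    (h : Growth K k a u) : Growth K k a (fun ε x => L (u ε x)) := by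
  refine Asymptotics.IsBigO.trans ?_ h
  refine Asymptotics.IsBigO.of_bound ‖L‖ ?_
  filter_upwards [eventually_mem K] with q hq
  have hn := hΩ.mem_nhds (hK hq)
  exact L.norm_iteratedFDeriv_comp_left (((hu q.1).contDiffAt hn)) (mod_cast le_top)

lemma Growth.congr {Ω K : Set E} (hΩ : IsOpen Ω) (hK : K ⊆ Ω) {k : ℕ} {a : ℤ}
    {u v : Par → E → F} (huv : ∀ ε, Set.EqOn (u ε) (v ε) Ω)
    (h : Growth K k a u) : Growth K k a v := by
  refine Asymptotics.IsBigO.congr' h ?_ EventuallyEq.rfl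
  filter_upwards [eventually_mem K] with q hq
  have : u q.1 =ᶠ[𝓝 q.2] v q.1 := by
    filter_upwards [hΩ.mem_nhds (hK hq)] with y hy using huv q.1 hy
  exact (this.iteratedFDeriv ℝ k).eq_of_nhds

lemma Growth.bilin {Ω K : Set E} (hΩ : IsOpen Ω) (hK : K ⊆ Ω) {k : ℕ} {a b : ℤ}
    {u : Par → E → F} {v : Par → E → G} (B : F →L[ℝ] G →L[ℝ] H)
    (hu : ∀ ε, ContDiffOn ℝ ∞ (u ε) Ω) (hv : ∀ ε, ContDiffOn ℝ ∞ (v ε) Ω)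
    (h : ∀ i ≤ k, Growth K i a u) (h' : ∀ i ≤ k, Growth K i b v) :
    Growth K k (a + b) (fun ε x => B (u ε x) (v ε x)) := by
  have key : (fun q : Par × E => ‖B‖ * ∑ i ∈ Finset.range (k + 1), (k.choose i : ℝ) *
      ‖iteratedFDeriv ℝ i (u q.1) q.2‖ * ‖iteratedFDeriv ℝ (k - i) (v q.1) q.2‖)
      =O[epsZero ×ˢ 𝓟 K] (fun q : Par × E => (q.1 : ℝ) ^ (a + b)) := by
    refine Asymptotics.IsBigO.const_mul_left (Asymptotics.IsBigO.fun_sum fun i hi => ?_) _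
    have hi' : i ≤ k := by simpa [Nat.lt_succ_iff] using hi
    have := (((h i hi').norm_left).const_mul_left (k.choose i : ℝ)).mul
      ((h' (k - i) (Nat.sub_le _ _)).norm_left)
    refine this.congr_right fun q => ?_
    rw [zpow_add₀ (ne_of_gt q.1.2.1)]
  refine Asymptotics.IsBigO.trans (isBigO_of_le fun ε x hx => ?_) key
  refine le_trans ?_ (le_abs_self _)
  have := B.norm_iteratedFDerivWithin_le_of_bilinear (hu ε) (hv ε) hΩ.uniqueDiffOn (hK hx)
    (n := k) (mod_cast le_top)
  simpa only [iteratedFDerivWithin_of_isOpen _ hΩ (hK hx)] using this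

lemma Growth.comp {Ω K : Set E} {Ω' : Set F} (hΩ : IsOpen Ω) (hΩ' : IsOpen Ω') (hK : K ⊆ Ω)
    {k : ℕ} {a b : ℤ} (hb : b ≤ 0) {g : Par → F → G} {f : Par → E → F}
    (hg : ∀ ε, ContDiffOn ℝ ∞ (g ε) Ω') (hf : ∀ ε, ContDiffOn ℝ ∞ (f ε) Ω)
    (hm : ∀ ε, Set.MapsTo (f ε) Ω Ω')
    (hC : ∀ i ≤ k, (fun q : Par × E => iteratedFDeriv ℝ i (g q.1) (f q.1 q.2))
      =O[epsZero ×ˢ 𝓟 K] (fun q : Par × E => (q.1 : ℝ) ^ a))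
    (hD : ∀ i ≤ k, Growth K i b f) :
    Growth K k (a + k * b) (fun ε x => g ε (f ε x)) := by
  have hC' : (fun q : Par × E => ∑ i ∈ Finset.range (k + 1),
      ‖iteratedFDeriv ℝ i (g q.1) (f q.1 q.2)‖) =O[epsZero ×ˢ 𝓟 K]
      (fun q : Par × E => (q.1 : ℝ) ^ a) :=
    Asymptotics.IsBigO.fun_sum fun i hi => (hC i (by simpa [Nat.lt_succ_iff] using hi)).norm_left
  have hD' : (fun q : Par × E => 1 + ∑ i ∈ Finset.range (k + 1),
      ‖iteratedFDeriv ℝ i (f q.1) q.2‖) =O[epsZero ×ˢ 𝓟 K]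
      (fun q : Par × E => (q.1 : ℝ) ^ b) := by
    refine Asymptotics.IsBigO.add ?_ (Asymptotics.IsBigO.fun_sum fun i hi =>
      (hD i (by simpa [Nat.lt_succ_iff] using hi)).norm_left)
    simpa using zpow_isBigO (K := K) hb
  have key := (hC'.const_mul_left (k.factorial : ℝ)).mul (hD'.pow k)
  refine Asymptotics.IsBigO.trans (isBigO_of_le fun ε x hx => ?_)
    (key.congr_right fun q => ?_)
  · refine le_trans ?_ (le_abs_self _)
    have := norm_iteratedFDerivWithin_comp_le (hg ε) (hf ε) (n := k) (mod_cast le_top)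
      hΩ'.uniqueDiffOn hΩ.uniqueDiffOn (hm ε) (hK hx)
      (C := ∑ i ∈ Finset.range (k + 1), ‖iteratedFDeriv ℝ i (g ε) (f ε x)‖)
      (D := 1 + ∑ i ∈ Finset.range (k + 1), ‖iteratedFDeriv ℝ i (f ε) x‖) ?_ ?_
    · rw [iteratedFDerivWithin_of_isOpen _ hΩ (hK hx)] at this
      exact this
    · intro i hi
      rw [iteratedFDerivWithin_of_isOpen _ hΩ' (hm ε (hK hx))]
      exact Finset.single_le_sum (f := fun i => ‖iteratedFDeriv ℝ i (g ε) (f ε x)‖)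
        (fun _ _ => norm_nonneg _) (Finset.mem_range.2 (by omega))
    · intro i hi1 hi
      rw [iteratedFDerivWithin_of_isOpen _ hΩ (hK hx)]
      have h1 : ‖iteratedFDeriv ℝ i (f ε) x‖
          ≤ ∑ i ∈ Finset.range (k + 1), ‖iteratedFDeriv ℝ i (f ε) x‖ :=
        Finset.single_le_sum (f := fun i => ‖iteratedFDeriv ℝ i (f ε) x‖)
          (fun _ _ => norm_nonneg _) (Finset.mem_range.2 (by omega))
      have h2 : (0 : ℝ) ≤ ∑ i ∈ Finset.range (k + 1), ‖iteratedFDeriv ℝ i (f ε) x‖ :=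
        Finset.sum_nonneg fun _ _ => norm_nonneg _
      refine le_trans ?_ (le_self_pow₀ (by linarith) (by omega))
      linarith
  · have h0 : ((q.1 : ℝ)) ≠ 0 := ne_of_gt q.1.2.1
    rw [zpow_add₀ h0, mul_comm (k : ℤ) b, zpow_mul, zpow_natCast]

lemma Growth.fderiv {K : Set E} {k : ℕ} {a : ℤ} {u : Par → E → F} (h : Growth K (k + 1) a u) :
    Growth K k a (fun ε => fderiv ℝ (u ε)) := by
  refine Asymptotics.IsBigO.trans (isBigO_of_le fun ε x _ => ?_) h
  exact le_of_eq norm_iteratedFDeriv_fderiv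

lemma Growth.of_fderiv {K : Set E} {k : ℕ} {a : ℤ} {u : Par → E → F}
    (h : Growth K k a (fun ε => _root_.fderiv ℝ (u ε))) : Growth K (k + 1) a u := by
  refine Asymptotics.IsBigO.trans (isBigO_of_le fun ε x _ => ?_) h
  exact le_of_eq norm_iteratedFDeriv_fderiv.symm

lemma IsModerate.fderiv {Ω : Set E} (hΩ : IsOpen Ω) {u : Par → E → F} (h : IsModerate Ω u) :
    IsModerate Ω (fun ε => fderiv ℝ (u ε)) :=
  ⟨fun ε => (h.1 ε).fderiv_of_isOpen hΩ (mod_cast le_top), fun K hK hKc k =>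
    (h.2 K hK hKc (k + 1)).imp fun _ hN => hN.fderiv⟩

lemma IsNegligible.fderiv {Ω : Set E} (hΩ : IsOpen Ω) {u : Par → E → F} (h : IsNegligible Ω u) :
    IsNegligible Ω (fun ε => fderiv ℝ (u ε)) :=
  ⟨fun ε => (h.1 ε).fderiv_of_isOpen hΩ (mod_cast le_top), fun K hK hKc k q =>
    (h.2 K hK hKc (k + 1) q).fderiv⟩

lemma IsNegligible.isModerate {Ω : Set E} {u : Par → E → F} (h : IsNegligible Ω u) :
    IsModerate Ω u :=
  ⟨h.1, fun K hK hKc k => ⟨0, by simpa using h.2 K hK hKc k 0⟩⟩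

lemma IsModerate.add {Ω : Set E} (hΩ : IsOpen Ω) {u v : Par → E → F} (hu : IsModerate Ω u)
    (hv : IsModerate Ω v) : IsModerate Ω (fun ε x => u ε x + v ε x) := by
  refine ⟨fun ε => (hu.1 ε).add (hv.1 ε), fun K hK hKc k => ?_⟩
  obtain ⟨N, hN⟩ := hu.2 K hK hKc k
  obtain ⟨N', hN'⟩ := hv.2 K hK hKc k
  exact ⟨N + N', (hN.mono (by push_cast; omega)).add hΩ hK hu.1 hv.1
    (hN'.mono (by push_cast; omega))⟩

lemma IsNegligible.add {Ω : Set E} (hΩ : IsOpen Ω) {u v : Par → E → F} (hu : IsNegligible Ω u)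
    (hv : IsNegligible Ω v) : IsNegligible Ω (fun ε x => u ε x + v ε x) :=
  ⟨fun ε => (hu.1 ε).add (hv.1 ε), fun K hK hKc k q =>
    (hu.2 K hK hKc k q).add hΩ hK hu.1 hv.1 (hv.2 K hK hKc k q)⟩

lemma IsModerate.clm {Ω : Set E} (hΩ : IsOpen Ω) {u : Par → E → F} (hu : IsModerate Ω u)
    (L : F →L[ℝ] G) : IsModerate Ω (fun ε x => L (u ε x)) :=
  ⟨fun ε => L.contDiff.comp_contDiffOn (hu.1 ε), fun K hK hKc k =>
    (hu.2 K hK hKc k).imp fun _ hN => hN.clm hΩ hK hu.1 L⟩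

lemma IsNegligible.clm {Ω : Set E} (hΩ : IsOpen Ω) {u : Par → E → F} (hu : IsNegligible Ω u)
    (L : F →L[ℝ] G) : IsNegligible Ω (fun ε x => L (u ε x)) :=
  ⟨fun ε => L.contDiff.comp_contDiffOn (hu.1 ε), fun K hK hKc k q =>
    (hu.2 K hK hKc k q).clm hΩ hK hu.1 L⟩

lemma IsNegligible.congr {Ω : Set E} (hΩ : IsOpen Ω) {u v : Par → E → F} (hu : IsNegligible Ω u)
    (huv : ∀ ε, Set.EqOn (u ε) (v ε) Ω) : IsNegligible Ω v :=
  ⟨fun ε => (hu.1 ε).congr fun _ hx => (huv ε hx).symm, fun K hK hKc k q =>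
    (hu.2 K hK hKc k q).congr hΩ hK huv⟩

lemma IsModerate.bilin {Ω : Set E} (hΩ : IsOpen Ω) {u : Par → E → F} {v : Par → E → G}
    (B : F →L[ℝ] G →L[ℝ] H) (hu : IsModerate Ω u) (hv : IsModerate Ω v) :
    IsModerate Ω (fun ε x => B (u ε x) (v ε x)) := by
  refine ⟨fun ε => B.isBoundedBilinearMap.contDiff.comp₂_contDiffOn (hu.1 ε) (hv.1 ε),
    fun K hK hKc k => ?_⟩
  obtain ⟨N, hN⟩ := hu.upTo hK hKc k
  obtain ⟨N', hN'⟩ := hv.upTo hK hKc k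
  exact ⟨N + N', (Growth.bilin hΩ hK B hu.1 hv.1 hN hN').mono (by push_cast; omega)⟩

lemma IsNegligible.bilin_left {Ω : Set E} (hΩ : IsOpen Ω) {u : Par → E → F} {v : Par → E → G}
    (B : F →L[ℝ] G →L[ℝ] H) (hu : IsNegligible Ω u) (hv : IsModerate Ω v) :
    IsNegligible Ω (fun ε x => B (u ε x) (v ε x)) := by
  refine ⟨(hu.isModerate.bilin hΩ B hv).1, fun K hK hKc k q => ?_⟩
  obtain ⟨N', hN'⟩ := hv.upTo hK hKc k
  exact (Growth.bilin hΩ hK B hu.1 hv.1 (fun i _ => hu.2 K hK hKc i (q + N')) hN').mono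
    (by push_cast; omega)

lemma IsNegligible.bilin_right {Ω : Set E} (hΩ : IsOpen Ω) {u : Par → E → F} {v : Par → E → G}
    (B : F →L[ℝ] G →L[ℝ] H) (hu : IsModerate Ω u) (hv : IsNegligible Ω v) :
    IsNegligible Ω (fun ε x => B (u ε x) (v ε x)) :=
  hv.bilin_left hΩ B.flip hu

lemma isModerate_const {Ω : Set E} (hΩ : IsOpen Ω) {f : E → F} (hf : ContDiffOn ℝ ∞ f Ω) :
    IsModerate Ω (fun _ => f) := by
  refine ⟨fun _ => hf, fun K hK hKc k => ⟨0, ?_⟩⟩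
  have hc : ContinuousOn (iteratedFDeriv ℝ k f) K := by
    refine ((hf.continuousOn_iteratedFDerivWithin (m := k) (mod_cast le_top)
      hΩ.uniqueDiffOn).mono hK).congr fun x hx => ?_
    rw [iteratedFDerivWithin_of_isOpen _ hΩ (hK hx)]
  obtain ⟨C, hC⟩ := hKc.exists_bound_of_continuousOn hc
  refine Asymptotics.IsBigO.of_bound C ?_
  filter_upwards [eventually_mem K] with q hq
  simpa using hC q.2 hq

/-- Pairing a moderate family with the identity. -/
lemma IsModerate.graph {Ω : Set E} (hΩ : IsOpen Ω) {w : Par → E → H} (hw : IsModerate Ω w) :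
    IsModerate Ω (fun ε x => (x, w ε x)) := by
  have h1 : IsModerate Ω (fun (_ : Par) (x : E) => x) := isModerate_const hΩ contDiffOn_id
  simpa using (h1.clm hΩ (ContinuousLinearMap.inl ℝ E H)).add hΩ
    (hw.clm hΩ (ContinuousLinearMap.inr ℝ E H))

/-- Componentwise insertion into a slowly increasing function preserves moderateness. -/
lemma IsModerate.insert {Ω : Set E} (hΩ : IsOpen Ω) {Φ : E × H → F}
    (hΦ : IsSlowlyIncreasing Ω Φ) {w : Par → E → H} (hw : IsModerate Ω w) :
    IsModerate Ω (fun ε x => Φ (x, w ε x)) := by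
  have hm : ∀ ε, Set.MapsTo (fun x => (x, w ε x)) Ω (Ω ×ˢ (Set.univ : Set H)) :=
    fun ε x hx => ⟨hx, Set.mem_univ _⟩
  have hgr := hw.graph hΩ
  refine ⟨fun ε => hΦ.1.comp (hgr.1 ε) (hm ε), fun K hK hKc k => ?_⟩
  obtain ⟨N, hN⟩ := hgr.upTo hK hKc k
  obtain ⟨N0, hN0⟩ := hw.upTo hK hKc 0
  have h1 : (fun q : Par × E => 1 + ‖w q.1 q.2‖) =O[epsZero ×ˢ 𝓟 K]
      (fun q : Par × E => (q.1 : ℝ) ^ (-(N0 : ℤ))) := by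
    refine Asymptotics.IsBigO.add ?_ ?_
    · simpa using zpow_isBigO (K := K) (a := -(N0 : ℤ)) (b := 0) (by omega)
    · have := (hN0 0 le_rfl).norm_left
      simpa [norm_iteratedFDeriv_zero] using this
  choose M C hC using hΦ.2 K hK hKc
  have h2 : ∀ i ≤ k, (fun q : Par × E => iteratedFDeriv ℝ i Φ (q.2, w q.1 q.2))
      =O[epsZero ×ˢ 𝓟 K]
      (fun q : Par × E => (q.1 : ℝ) ^ (-(N0 : ℤ) * ∑ i ∈ Finset.range (k + 1), (M i : ℤ))) := by
    intro i hi
    have h3 := ((h1.pow (M i)).const_mul_left (C i))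
    refine Asymptotics.IsBigO.trans (isBigO_of_le fun ε x hx => ?_)
      (h3.trans ?_)
    · exact (hC i x hx (w ε x)).trans (le_abs_self _)
    · have : (fun q : Par × E => ((q.1 : ℝ) ^ (-(N0 : ℤ))) ^ M i)
          = fun q : Par × E => (q.1 : ℝ) ^ (-(N0 : ℤ) * (M i : ℤ)) := by
        funext q
        rw [zpow_mul, zpow_natCast]
      rw [this]
      refine zpow_isBigO ?_
      have h4 : (M i : ℤ) ≤ ∑ i ∈ Finset.range (k + 1), (M i : ℤ) :=
        Finset.single_le_sum (f := fun i => (M i : ℤ)) (fun _ _ => by positivity)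
          (Finset.mem_range.2 (by omega))
      nlinarith [(Nat.cast_nonneg N0 : (0 : ℤ) ≤ N0)]
  have key := Growth.comp hΩ (hΩ.prod isOpen_univ) hK (b := -(N : ℤ)) (by omega)
    (g := fun _ => Φ) (fun _ => hΦ.1) hgr.1 hm h2 hN
  refine ⟨(N0 * ∑ i ∈ Finset.range (k + 1), M i) + k * N, key.mono (le_of_eq ?_)⟩
  push_cast
  ring

lemma IsSlowlyIncreasing.fderiv {Ω : Set E} (hΩ : IsOpen Ω) {Φ : E × H → F}
    (hΦ : IsSlowlyIncreasing Ω Φ) : IsSlowlyIncreasing Ω (fderiv ℝ Φ) := by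
  refine ⟨hΦ.1.fderiv_of_isOpen (hΩ.prod isOpen_univ) (mod_cast le_top), fun K hK hKc k => ?_⟩
  obtain ⟨N, C, h⟩ := hΦ.2 K hK hKc (k + 1)
  exact ⟨N, C, fun x hx w => by rw [norm_iteratedFDeriv_fderiv]; exact h x hx w⟩

lemma growth_insert_sub {Ω : Set E} (hΩ : IsOpen Ω) {w w' : Par → E → H}
    (hw : IsModerate Ω w) (hw' : IsModerate Ω w')
    (hd : IsNegligible Ω (fun ε x => w ε x - w' ε x)) {K : Set E} (hK : K ⊆ Ω)
    (hKc : IsCompact K) (k : ℕ) :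
    ∀ {F : Type} [NormedAddCommGroup F] [NormedSpace ℝ F] {Φ : E × H → F},
      IsSlowlyIncreasing Ω Φ → ∀ q : ℕ,
        Growth K k (q : ℤ) (fun ε x => Φ (x, w ε x) - Φ (x, w' ε x)) := by
  have hO : IsOpen (Ω ×ˢ (Set.univ : Set H)) := hΩ.prod isOpen_univ
  induction k using Nat.strong_induction_on with
  | _ k ih =>
  cases k with
  | zero =>
    intro F _ _ Φ hΦ q
    obtain ⟨N, C, hC⟩ := hΦ.2 K hK hKc 1
    obtain ⟨N0, hN0⟩ := hw.2 K hK hKc 0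
    obtain ⟨N1, hN1⟩ := hw'.2 K hK hKc 0
    have h1 : (fun q : Par × E => 1 + (‖w q.1 q.2‖ + ‖w' q.1 q.2‖)) =O[epsZero ×ˢ 𝓟 K]
        (fun q : Par × E => (q.1 : ℝ) ^ (-((N0 + N1 : ℕ) : ℤ))) := by
      refine Asymptotics.IsBigO.add ?_ (Asymptotics.IsBigO.add ?_ ?_)
      · simpa using zpow_isBigO (K := K) (a := -((N0 + N1 : ℕ) : ℤ)) (b := 0) (by omega)
      · have := (hN0.mono (a := -((N0 + N1 : ℕ) : ℤ)) (by push_cast; omega)).norm_left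
        simpa [norm_iteratedFDeriv_zero] using this
      · have := (hN1.mono (a := -((N0 + N1 : ℕ) : ℤ)) (by push_cast; omega)).norm_left
        simpa [norm_iteratedFDeriv_zero] using this
    have h2 := (hd.2 K hK hKc 0 (q + (N0 + N1) * N)).norm_left
    have h3 := ((h1.pow N).const_mul_left |C|).mul h2
    refine Asymptotics.IsBigO.trans (isBigO_of_le fun ε x hx => ?_)
      (h3.congr_right fun r => ?_)
    · refine le_trans ?_ (le_abs_self _)
      rw [norm_iteratedFDeriv_zero, norm_iteratedFDeriv_zero]
      have hb : ∀ z ∈ segment ℝ (x, w' ε x) (x, w ε x),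
          ‖_root_.fderiv ℝ Φ z‖ ≤ |C| * (1 + (‖w ε x‖ + ‖w' ε x‖)) ^ N ∧
            DifferentiableAt ℝ Φ z := by
        rintro z ⟨s, t, hs, ht, hst, rfl⟩
        have hz : s • (x, w' ε x) + t • (x, w ε x) = (x, s • w' ε x + t • w ε x) := by
          simp [← add_smul, hst]
        rw [hz]
        have hmem : (x, s • w' ε x + t • w ε x) ∈ Ω ×ˢ (Set.univ : Set H) :=
          ⟨hK hx, Set.mem_univ _⟩
        refine ⟨?_, ((hΦ.1.contDiffAt (hO.mem_nhds hmem)).differentiableAt (by simp))⟩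
        have h4 := hC x hx (s • w' ε x + t • w ε x)
        rw [norm_iteratedFDeriv_one] at h4
        refine h4.trans ?_
        have h5 : ‖s • w' ε x + t • w ε x‖ ≤ ‖w ε x‖ + ‖w' ε x‖ := by
          refine (norm_add_le _ _).trans ?_
          rw [norm_smul, norm_smul, Real.norm_of_nonneg hs, Real.norm_of_nonneg ht]
          have hs1 : s ≤ 1 := by linarith
          have ht1 : t ≤ 1 := by linarith
          nlinarith [norm_nonneg (w ε x), norm_nonneg (w' ε x)]
        have h6 : (0 : ℝ) ≤ 1 + ‖s • w' ε x + t • w ε x‖ := by positivity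
        refine (mul_le_mul_of_nonneg_right (le_abs_self C) (by positivity)).trans ?_
        gcongr
      have h7 := (convex_segment (𝕜 := ℝ) (x, w' ε x) (x, w ε x)).norm_image_sub_le_of_norm_fderiv_le
        (fun z hz => (hb z hz).2) (fun z hz => (hb z hz).1) (left_mem_segment ℝ _ _)
        (right_mem_segment ℝ _ _)
      refine h7.trans (le_of_eq ?_)
      congr 1
      simp [Prod.norm_def]
    · have h0 : ((r.1 : ℝ)) ≠ 0 := ne_of_gt r.1.2.1
      rw [← zpow_natCast, ← zpow_mul, ← zpow_add₀ h0]
      congr 1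
      push_cast
      ring
  | succ k =>
    intro F _ _ Φ hΦ q
    have hgr := hw.graph hΩ
    have hgr' := hw'.graph hΩ
    have hm : ∀ ε, Set.MapsTo (fun x => (x, w ε x)) Ω (Ω ×ˢ (Set.univ : Set H)) :=
      fun ε x hx => ⟨hx, Set.mem_univ _⟩
    have hm' : ∀ ε, Set.MapsTo (fun x => (x, w' ε x)) Ω (Ω ×ˢ (Set.univ : Set H)) :=
      fun ε x hx => ⟨hx, Set.mem_univ _⟩
    have hDΦ := hΦ.fderiv hΩ
    have hDg : IsModerate Ω (fun ε => _root_.fderiv ℝ (fun x => (x, w ε x))) := hgr.fderiv hΩ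
    have hDg' : IsModerate Ω (fun ε => _root_.fderiv ℝ (fun x => (x, w' ε x))) := hgr'.fderiv hΩ
    have hDd : IsNegligible Ω (fun ε x => _root_.fderiv ℝ (fun x => (x, w ε x)) x
        - _root_.fderiv ℝ (fun x => (x, w' ε x)) x) := by
      refine ((hd.clm hΩ (ContinuousLinearMap.inr ℝ E H)).fderiv hΩ).congr hΩ fun ε x hx => ?_
      have hn := hΩ.mem_nhds hx
      have e1 : DifferentiableAt ℝ (fun x => (x, w ε x)) x :=
        ((hgr.1 ε).contDiffAt hn).differentiableAt (by simp)
      have e2 : DifferentiableAt ℝ (fun x => (x, w' ε x)) x :=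
        ((hgr'.1 ε).contDiffAt hn).differentiableAt (by simp)
      rw [← fderiv_fun_sub e1 e2]
      congr 1
      funext y
      simp
    have hA : IsModerate Ω (fun ε x => _root_.fderiv ℝ Φ (x, w ε x)) := hw.insert hΩ hDΦ
    have hB : IsModerate Ω (fun ε x => _root_.fderiv ℝ Φ (x, w' ε x)) := hw'.insert hΩ hDΦ
    let L := ContinuousLinearMap.compL ℝ E (E × H) F
    have p1 : Growth K k (q : ℤ) (fun ε x => L (_root_.fderiv ℝ Φ (x, w ε x)
        - _root_.fderiv ℝ Φ (x, w' ε x)) (_root_.fderiv ℝ (fun x => (x, w ε x)) x)) := by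
      obtain ⟨N, hN⟩ := hDg.upTo hK hKc k
      refine (Growth.bilin hΩ hK L (fun ε => (hA.1 ε).sub (hB.1 ε)) hDg.1
        (fun i hi => ih i (by omega) hDΦ (q + N)) hN).mono (by push_cast; omega)
    have p2 : Growth K k (q : ℤ) (fun ε x => L (_root_.fderiv ℝ Φ (x, w' ε x))
        (_root_.fderiv ℝ (fun x => (x, w ε x)) x - _root_.fderiv ℝ (fun x => (x, w' ε x)) x)) :=
      (hDd.bilin_right hΩ L hB).2 K hK hKc k q
    refine Growth.of_fderiv (Growth.congr hΩ hK (fun ε x hx => ?_) (p1.add hΩ hK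
      (fun ε => L.isBoundedBilinearMap.contDiff.comp₂_contDiffOn ((hA.1 ε).sub (hB.1 ε)) (hDg.1 ε))
      (hDd.bilin_right hΩ L hB).1 p2))
    have hn := hΩ.mem_nhds hx
    have e1 : DifferentiableAt ℝ (fun x => (x, w ε x)) x :=
      ((hgr.1 ε).contDiffAt hn).differentiableAt (by simp)
    have e2 : DifferentiableAt ℝ (fun x => (x, w' ε x)) x :=
      ((hgr'.1 ε).contDiffAt hn).differentiableAt (by simp)
    have d1 : DifferentiableAt ℝ Φ (x, w ε x) :=
      (hΦ.1.contDiffAt (hO.mem_nhds (hm ε hx))).differentiableAt (by simp)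
    have d2 : DifferentiableAt ℝ Φ (x, w' ε x) :=
      (hΦ.1.contDiffAt (hO.mem_nhds (hm' ε hx))).differentiableAt (by simp)
    have c1 := (d1.hasFDerivAt.comp x e1.hasFDerivAt).fun_sub (d2.hasFDerivAt.comp x e2.hasFDerivAt)
    refine Eq.trans ?_ c1.fderiv.symm
    simp only [L, ContinuousLinearMap.compL_apply, ContinuousLinearMap.sub_comp,
      ContinuousLinearMap.comp_sub]
    abel

/-- Componentwise insertion into a slowly increasing function respects negligible changes. -/
lemma isNegligible_insert_sub {Ω : Set E} (hΩ : IsOpen Ω) {Φ : E × H → F}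
    (hΦ : IsSlowlyIncreasing Ω Φ) {w w' : Par → E → H}
    (hw : IsModerate Ω w) (hw' : IsModerate Ω w')
    (hd : IsNegligible Ω (fun ε x => w ε x - w' ε x)) :
    IsNegligible Ω (fun ε x => Φ (x, w ε x) - Φ (x, w' ε x)) :=
  ⟨fun ε => ((hw.insert hΩ hΦ).1 ε).sub ((hw'.insert hΩ hΦ).1 ε), fun _ hK hKc k q =>
    growth_insert_sub hΩ hw hw' hd hK hKc k hΦ q⟩

lemma growth_pullback {Ω : Set F} {Ω' K : Set E} (hΩ : IsOpen Ω) (hΩ' : IsOpen Ω')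
    (hK : K ⊆ Ω') (hKc : IsCompact K)
    {χ : E → F} (hχ : ContDiffOn ℝ ∞ χ Ω') (hm : Set.MapsTo χ Ω' Ω) {u : Par → F → G}
    (hu : ∀ ε, ContDiffOn ℝ ∞ (u ε) Ω) {k : ℕ} {a : ℤ}
    (h : ∀ i ≤ k, Growth (χ '' K) i a u) : Growth K k a (fun ε x => u ε (χ x)) := by
  have hc := (isModerate_const hΩ' hχ).2 K hK hKc
  have hD : ∀ i ≤ k, Growth K i 0 (fun _ : Par => χ) := by
    intro i _
    obtain ⟨C, hC⟩ := hKc.exists_bound_of_continuousOn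
      (((hχ.continuousOn_iteratedFDerivWithin (m := i) (mod_cast le_top)
        hΩ'.uniqueDiffOn).mono hK))
    refine Asymptotics.IsBigO.of_bound C ?_
    filter_upwards [eventually_mem K] with q hq
    simpa [iteratedFDerivWithin_of_isOpen _ hΩ' (hK hq)] using hC q.2 hq
  have hC : ∀ i ≤ k, (fun q : Par × E => iteratedFDeriv ℝ i (u q.1) (χ q.2))
      =O[epsZero ×ˢ 𝓟 K] (fun q : Par × E => (q.1 : ℝ) ^ a) := by
    intro i hi
    have ht : Tendsto (fun q : Par × E => (q.1, χ q.2)) (epsZero ×ˢ 𝓟 K)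
        (epsZero ×ˢ 𝓟 (χ '' K)) :=
      tendsto_id.prodMap (tendsto_principal_principal.2 fun x hx => ⟨x, hx, rfl⟩)
    exact (h i hi).comp_tendsto ht
  simpa using Growth.comp hΩ' hΩ hK le_rfl hu (fun _ => hχ) (fun _ => hm) hC hD

lemma IsModerate.pullback {Ω : Set F} {Ω' : Set E} (hΩ : IsOpen Ω) (hΩ' : IsOpen Ω')
    {χ : E → F} (hχ : ContDiffOn ℝ ∞ χ Ω') (hm : Set.MapsTo χ Ω' Ω) {u : Par → F → G}
    (hu : IsModerate Ω u) : IsModerate Ω' (fun ε x => u ε (χ x)) := by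
  refine ⟨fun ε => (hu.1 ε).comp hχ hm, fun K hK hKc k => ?_⟩
  obtain ⟨N, hN⟩ := hu.upTo ((Set.image_mono hK).trans hm.image_subset)
    (hKc.image_of_continuousOn (hχ.continuousOn.mono hK)) k
  exact ⟨N, growth_pullback hΩ hΩ' hK hKc hχ hm hu.1 hN⟩

lemma IsNegligible.pullback {Ω : Set F} {Ω' : Set E} (hΩ : IsOpen Ω) (hΩ' : IsOpen Ω')
    {χ : E → F} (hχ : ContDiffOn ℝ ∞ χ Ω') (hm : Set.MapsTo χ Ω' Ω) {u : Par → F → G}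
    (hu : IsNegligible Ω u) : IsNegligible Ω' (fun ε x => u ε (χ x)) :=
  ⟨fun ε => (hu.1 ε).comp hχ hm, fun _ hK hKc _ q =>
    growth_pullback hΩ hΩ' hK hKc hχ hm hu.1 fun i _ =>
      hu.2 _ ((Set.image_mono hK).trans hm.image_subset)
        (hKc.image_of_continuousOn (hχ.continuousOn.mono hK)) i q⟩

lemma norm_iteratedFDeriv_of_isometry (e : F ≃ₗᵢ[ℝ] G) (f : E → F) (g : E → G)
    (h : ∀ y, g y = e (f y)) (x : E) (k : ℕ) :
    ‖iteratedFDeriv ℝ k g x‖ = ‖iteratedFDeriv ℝ k f x‖ := by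
  rw [show g = e ∘ f from funext h]
  exact e.norm_iteratedFDeriv_comp_left f x k

lemma norm_iteratedFDeriv_iteratedFDeriv (x : E) (k m : ℕ) :
    ∀ {F : Type} [NormedAddCommGroup F] [NormedSpace ℝ F] (f : E → F),
      ‖iteratedFDeriv ℝ k (iteratedFDeriv ℝ m f) x‖ = ‖iteratedFDeriv ℝ (k + m) f x‖ := by
  induction m with
  | zero =>
    intro F _ _ f
    exact norm_iteratedFDeriv_of_isometry (continuousMultilinearCurryFin0 ℝ E F).symm f _
      (fun _ => rfl) x k
  | succ m ih =>
    intro F _ _ f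
    refine (norm_iteratedFDeriv_of_isometry (continuousMultilinearCurryRightEquiv' ℝ m E F).symm
      (iteratedFDeriv ℝ m (fderiv ℝ f)) _ (fun _ => iteratedFDeriv_succ_eq_comp_right) x k).trans ?_
    rw [ih, norm_iteratedFDeriv_fderiv, Nat.add_assoc]

lemma growth_iteratedFDeriv {K : Set E} {a : ℤ} {u : Par → E → F} (m k : ℕ)
    (h : Growth K (k + m) a u) : Growth K k a (fun ε => iteratedFDeriv ℝ m (u ε)) :=
  Asymptotics.IsBigO.trans
    (isBigO_of_le fun ε x _ => le_of_eq (norm_iteratedFDeriv_iteratedFDeriv x k m (u ε))) h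

end Growth

/-! ### The Colombeau algebra -/

/-- The space of independent variables. -/
abbrev Sp (p : ℕ) : Type := EuclideanSpace ℝ (Fin p)

/-- The algebra of moderate families on `Ω`. -/
def moderateAlg {p : ℕ} (Ω : Opens (Sp p)) : Subalgebra ℝ (Par → Sp p → ℝ) where
  carrier := {u | IsModerate (Ω : Set (Sp p)) u}
  mul_mem' hu hv :=
    IsModerate.bilin Ω.isOpen (ContinuousLinearMap.mul ℝ ℝ) hu hv
  add_mem' hu hv := IsModerate.add Ω.isOpen hu hv
  algebraMap_mem' _ := isModerate_const Ω.isOpen contDiffOn_const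

/-- The ideal of negligible families on `Ω`. -/
def negligibleIdeal {p : ℕ} (Ω : Opens (Sp p)) : Ideal (moderateAlg Ω) where
  carrier := {u | IsNegligible (Ω : Set (Sp p)) u.1}
  add_mem' hu hv := IsNegligible.add Ω.isOpen hu hv
  zero_mem' := by
    refine ⟨fun ε => contDiffOn_const, fun _ _ _ k _ => ?_⟩
    have : (fun q : Par × Sp p => iteratedFDeriv ℝ k
        (((0 : moderateAlg Ω) : Par → Sp p → ℝ) q.1) q.2) = fun _ => 0 := by
      funext q
      have : ((0 : moderateAlg Ω) : Par → Sp p → ℝ) q.1 = fun _ => 0 := rfl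
      rw [this]
      simp
    rw [Growth, this]
    exact Asymptotics.isBigO_zero _ _
  smul_mem' c _ hu :=
    IsNegligible.bilin_right Ω.isOpen (ContinuousLinearMap.mul ℝ ℝ) c.2 hu

/-- The (special) Colombeau algebra `𝒢(Ω) = ℰ_M(Ω) / 𝒩(Ω)`. -/
abbrev Colombeau {p : ℕ} (Ω : Opens (Sp p)) : Type := moderateAlg Ω ⧸ negligibleIdeal Ω

/-- The class of a moderate family. -/
def cl {p : ℕ} {Ω : Opens (Sp p)} (u : Par → Sp p → ℝ) (hu : IsModerate (Ω : Set (Sp p)) u) :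
    Colombeau Ω :=
  Ideal.Quotient.mk (negligibleIdeal Ω) ⟨u, hu⟩

/-- A map on representatives that preserves moderateness and negligibility of differences induces
a map of Colombeau algebras. -/
def liftMap {p : ℕ} {Ω Ω' : Opens (Sp p)} (T : (Par → Sp p → ℝ) → (Par → Sp p → ℝ))
    (h1 : ∀ u, IsModerate (Ω : Set (Sp p)) u → IsModerate (Ω' : Set (Sp p)) (T u))
    (h2 : ∀ u v, IsModerate (Ω : Set (Sp p)) u → IsModerate (Ω : Set (Sp p)) v →
      IsNegligible (Ω : Set (Sp p)) (fun ε x => u ε x - v ε x) →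
      IsNegligible (Ω' : Set (Sp p)) (fun ε x => T u ε x - T v ε x)) :
    Colombeau Ω → Colombeau Ω' :=
  Quotient.lift (fun u : moderateAlg Ω => cl (T u.1) (h1 u.1 u.2)) (by
    intro u v huv
    have : u - v ∈ negligibleIdeal Ω := by
      rw [← Submodule.quotientRel_def]
      exact huv
    exact (Ideal.Quotient.mk_eq_mk_iff_sub_mem _ _).2 (h2 u.1 v.1 u.2 v.2 this))

lemma liftMap_cl {p : ℕ} {Ω Ω' : Opens (Sp p)} (T : (Par → Sp p → ℝ) → (Par → Sp p → ℝ))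
    (h1 : ∀ u, IsModerate (Ω : Set (Sp p)) u → IsModerate (Ω' : Set (Sp p)) (T u))
    (h2 : ∀ u v, IsModerate (Ω : Set (Sp p)) u → IsModerate (Ω : Set (Sp p)) v →
      IsNegligible (Ω : Set (Sp p)) (fun ε x => u ε x - v ε x) →
      IsNegligible (Ω' : Set (Sp p)) (fun ε x => T u ε x - T v ε x))
    (u : Par → Sp p → ℝ) (hu : IsModerate (Ω : Set (Sp p)) u) :
    liftMap T h1 h2 (cl u hu) = cl (T u) (h1 u hu) := rfl

/-! ### Jets and differential equations -/

/-- The multi-indices `α ∈ ℕ^p` with `|α| ≤ n`. -/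
abbrev MultiIdx (p n : ℕ) : Type := {α : Fin p → Fin (n + 1) // ∑ i, (α i : ℕ) ≤ n}

/-- The zero multi-index. -/
def zeroIdx (p n : ℕ) : MultiIdx p n := ⟨fun _ => 0, by simp⟩

/-- The fibre `𝒰^(n)` of the `n`-jet space: the coordinates `u_α`, `|α| ≤ n`. -/
abbrev Jet (p n : ℕ) : Type := MultiIdx p n → ℝ

/-- The directions of `∂^α`: the `i`-th unit vector repeated `α i` times, for each `i`. -/
def dirs {p n : ℕ} (α : MultiIdx p n) : Fin (∑ i, (α.1 i : ℕ)) → Sp p :=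
  fun j => EuclideanSpace.single (finSigmaFinEquiv.symm j).1 1

/-- The partial derivative `∂^α f (x)`. -/
def partialD {p n : ℕ} (α : MultiIdx p n) (f : Sp p → ℝ) (x : Sp p) : ℝ :=
  iteratedFDeriv ℝ (∑ i, (α.1 i : ℕ)) f x (dirs α)

/-- The point `pr^(n) f (x) = (∂^α f (x))_{|α| ≤ n}`. -/
def jet {p : ℕ} (n : ℕ) (f : Sp p → ℝ) (x : Sp p) : Jet p n := fun α => partialD α f x

lemma partialD_eq {p n : ℕ} (α : MultiIdx p n) (f : Sp p → ℝ) :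
    partialD α f = fun x => ContinuousMultilinearMap.apply ℝ
      (fun _ : Fin (∑ i, (α.1 i : ℕ)) => Sp p) ℝ (dirs α)
      (iteratedFDeriv ℝ (∑ i, (α.1 i : ℕ)) f x) := rfl

lemma contDiffOn_iteratedFDeriv {p : ℕ} {Ω : Set (Sp p)} (hΩ : IsOpen Ω) {f : Sp p → ℝ}
    (hf : ContDiffOn ℝ ∞ f Ω) (m : ℕ) : ContDiffOn ℝ ∞ (iteratedFDeriv ℝ m f) Ω := by
  intro x hx
  exact ((hf.contDiffAt (hΩ.mem_nhds hx)).iteratedFDeriv_right (m := ∞) (i := m)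
    (by norm_cast)).contDiffWithinAt

lemma jet_eq_sum {p n : ℕ} (f : Sp p → ℝ) (x : Sp p) : jet n f x =
    ∑ α : MultiIdx p n, ContinuousLinearMap.single ℝ (fun _ : MultiIdx p n => ℝ) α
      (partialD α f x) := by
  funext α
  simp [jet, Finset.sum_apply, Pi.single_apply]

/-- Prolongation to jets preserves moderateness. -/
lemma IsModerate.jet {p : ℕ} (n : ℕ) {Ω : Set (Sp p)} (hΩ : IsOpen Ω) {u : Par → Sp p → ℝ}
    (hu : IsModerate Ω u) : IsModerate Ω (fun ε => GenSymm.jet n (u ε)) := by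
  have h1 : ∀ m : ℕ, IsModerate Ω (fun ε => iteratedFDeriv ℝ m (u ε)) := fun m =>
    ⟨fun ε => contDiffOn_iteratedFDeriv hΩ (hu.1 ε) m, fun K hK hKc k =>
      (hu.2 K hK hKc (k + m)).imp fun _ h => growth_iteratedFDeriv m k h⟩
  have h2 : ∀ α : MultiIdx p n, IsModerate Ω (fun ε x =>
      ContinuousLinearMap.single ℝ (fun _ : MultiIdx p n => ℝ) α (partialD α (u ε) x)) :=
    fun α => ((h1 _).clm hΩ (ContinuousMultilinearMap.apply ℝ
      (fun _ : Fin (∑ i, (α.1 i : ℕ)) => Sp p) ℝ (dirs α))).clm hΩ _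
  have h3 : ∀ s : Finset (MultiIdx p n), IsModerate Ω (fun ε x => ∑ α ∈ s,
      ContinuousLinearMap.single ℝ (fun _ : MultiIdx p n => ℝ) α (partialD α (u ε) x)) := by
    classical
    intro s
    induction s using Finset.induction_on with
    | empty => simpa using isModerate_const hΩ (contDiffOn_const (c := (0 : Jet p n)))
    | insert α s hα ih =>
      simp only [Finset.sum_insert hα]
      exact (h2 α).add hΩ ih
  have h4 : (fun ε => GenSymm.jet n (u ε)) = fun (ε : Par) (x : Sp p) => ∑ α : MultiIdx p n,
      ContinuousLinearMap.single ℝ (fun _ : MultiIdx p n => ℝ) α (partialD α (u ε) x) := by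
    funext ε x
    exact jet_eq_sum _ _
  rw [h4]
  exact h3 Finset.univ

/-- Prolongation to jets respects negligible changes. -/
lemma IsNegligible.jet {p : ℕ} (n : ℕ) {Ω : Set (Sp p)} (hΩ : IsOpen Ω) {u v : Par → Sp p → ℝ}
    (hu : IsModerate Ω u) (hv : IsModerate Ω v)
    (hd : IsNegligible Ω (fun ε x => u ε x - v ε x)) :
    IsNegligible Ω (fun ε x => GenSymm.jet n (u ε) x - GenSymm.jet n (v ε) x) := by
  have h1 : ∀ m : ℕ, IsNegligible Ω
      (fun ε => iteratedFDeriv ℝ m (fun x => u ε x - v ε x)) := fun m =>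
    ⟨fun ε => contDiffOn_iteratedFDeriv hΩ (hd.1 ε) m, fun K hK hKc k q =>
      growth_iteratedFDeriv m k (hd.2 K hK hKc (k + m) q)⟩
  have h2 : ∀ α : MultiIdx p n, IsNegligible Ω (fun ε x =>
      ContinuousLinearMap.single ℝ (fun _ : MultiIdx p n => ℝ) α
        (partialD α (fun x => u ε x - v ε x) x)) :=
    fun α => ((h1 _).clm hΩ (ContinuousMultilinearMap.apply ℝ
      (fun _ : Fin (∑ i, (α.1 i : ℕ)) => Sp p) ℝ (dirs α))).clm hΩ _
  have h0 : IsNegligible Ω (fun (_ : Par) (_ : Sp p) => (0 : Jet p n)) := by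
    simpa using hd.clm hΩ (0 : ℝ →L[ℝ] Jet p n)
  have h3 : ∀ s : Finset (MultiIdx p n), IsNegligible Ω (fun ε x => ∑ α ∈ s,
      ContinuousLinearMap.single ℝ (fun _ : MultiIdx p n => ℝ) α
        (partialD α (fun x => u ε x - v ε x) x)) := by
    classical
    intro s
    induction s using Finset.induction_on with
    | empty => simpa using h0
    | insert α s hα ih =>
      simp only [Finset.sum_insert hα]
      exact (h2 α).add hΩ ih
  refine (h3 Finset.univ).congr hΩ fun ε x hx => ?_
  dsimp only
  rw [← jet_eq_sum]
  have hn := hΩ.mem_nhds hx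
  funext α
  simp only [GenSymm.jet, partialD, Pi.sub_apply]
  rw [fun_iteratedFDeriv_sub_apply (((hu.1 ε).contDiffAt hn).of_le (mod_cast le_top))
    (((hv.1 ε).contDiffAt hn).of_le (mod_cast le_top))]
  rfl

/-- The element `Δ(·, pr^(n) U)` of `𝒢(Ω)`, obtained by componentwise insertion of `U ∈ 𝒢(Ω)` into
the slowly increasing function `Δ(x, u^(n))`. -/
def evalPDE {p n : ℕ} {Δ : Sp p × Jet p n → ℝ} (hΔ : IsSlowlyIncreasing Set.univ Δ)
    (Ω : Opens (Sp p)) : Colombeau Ω → Colombeau Ω :=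
  have hΔ' : IsSlowlyIncreasing (Ω : Set (Sp p)) Δ :=
    ⟨hΔ.1.mono (Set.prod_mono (Set.subset_univ _) subset_rfl), fun K _ => hΔ.2 K (Set.subset_univ _)⟩
  liftMap (fun u ε x => Δ (x, jet n (u ε) x))
    (fun _ hu => (hu.jet n Ω.isOpen).insert Ω.isOpen hΔ')
    (fun _ _ hu hv hd => isNegligible_insert_sub Ω.isOpen hΔ' (hu.jet n Ω.isOpen)
      (hv.jet n Ω.isOpen) (IsNegligible.jet n Ω.isOpen hu hv hd))

/-- `U ∈ 𝒢(Ω)` solves `Δ(x, u^(n)) = 0` in `𝒢(Ω)`. -/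
def IsGenSolution {p n : ℕ} {Δ : Sp p × Jet p n → ℝ} (hΔ : IsSlowlyIncreasing Set.univ Δ)
    {Ω : Opens (Sp p)} (U : Colombeau Ω) : Prop :=
  evalPDE hΔ Ω U = 0

/-- `f` is a classical (smooth) solution of `Δ(x, u^(n)) = 0` on `Ω`. -/
def IsSmoothSolution {p n : ℕ} (Δ : Sp p × Jet p n → ℝ) (Ω : Set (Sp p)) (f : Sp p → ℝ) : Prop :=
  ContDiffOn ℝ ∞ f Ω ∧ ∀ x ∈ Ω, Δ (x, jet n f x) = 0

/-! ### Projectable local one-parameter transformation groups -/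

/-- A projectable local one-parameter group of transformations `g_η (x,u) = (Ξ_η(x), Φ_η(x,u))`
acting on an open set `M` of the space `ℝ^p × ℝ` of independent and dependent variables.
It is defined and smooth on the open set `dom ⊆ ℝ × M`; the values of `Xi` and `Phi` elsewhere play
no role. -/
structure LocalGroup (p : ℕ) where
  M : Set (Sp p × ℝ)
  isOpen_M : IsOpen M
  dom : Set (ℝ × (Sp p × ℝ))
  isOpen_dom : IsOpen dom
  Xi : ℝ → Sp p → Sp p
  Phi : ℝ → Sp p × ℝ → ℝ
  smooth : ContDiffOn ℝ ∞ (fun q : ℝ × (Sp p × ℝ) => (Xi q.1 q.2.1, Phi q.1 q.2)) dom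
  mem_of_dom : ∀ {η : ℝ} {z : Sp p × ℝ}, (η, z) ∈ dom → z ∈ M
  maps : ∀ {η : ℝ} {z : Sp p × ℝ}, (η, z) ∈ dom → (Xi η z.1, Phi η z) ∈ M
  zero_mem : ∀ {z : Sp p × ℝ}, z ∈ M → ((0 : ℝ), z) ∈ dom
  zero_act : ∀ {z : Sp p × ℝ}, z ∈ M → (Xi 0 z.1, Phi 0 z) = z
  neg_mem : ∀ {η : ℝ} {z : Sp p × ℝ}, (η, z) ∈ dom → (-η, (Xi η z.1, Phi η z)) ∈ dom
  neg_act : ∀ {η : ℝ} {z : Sp p × ℝ}, (η, z) ∈ dom →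
    (Xi (-η) (Xi η z.1), Phi (-η) (Xi η z.1, Phi η z)) = z
  add_act : ∀ {η θ : ℝ} {z : Sp p × ℝ}, (η, z) ∈ dom → (θ, (Xi η z.1, Phi η z)) ∈ dom →
    (θ + η, z) ∈ dom →
    (Xi θ (Xi η z.1), Phi θ (Xi η z.1, Phi η z)) = (Xi (θ + η) z.1, Phi (θ + η) z)

namespace LocalGroup

variable {p : ℕ}

/-- The transformed function `g_η f = (Φ_η ∘ (id × f)) ∘ Ξ_η⁻¹`, where `Ξ_η⁻¹ = Ξ_{-η}`. -/
def actFun (g : LocalGroup p) (η : ℝ) (f : Sp p → ℝ) : Sp p → ℝ :=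
  fun y => g.Phi η (g.Xi (-η) y, f (g.Xi (-η) y))

/-- `g_η` is defined on `Ω × ℝ`. As the values of the representatives of an element of `𝒢(Ω)` are
unrestricted, this is the condition under which `g_η` acts on elements of `𝒢(Ω)`. -/
def DefinedOver (g : LocalGroup p) (η : ℝ) (Ω : Set (Sp p)) : Prop :=
  ∀ x ∈ Ω, ∀ u : ℝ, (η, (x, u)) ∈ g.dom

/-- The group is slowly increasing: for each `η` the map `u ↦ Φ_η(x,u)` is slowly increasing,
uniformly for `x` in compact sets. -/
def SlowlyIncreasing (g : LocalGroup p) : Prop :=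
  ∀ (η : ℝ) (Ω : Opens (Sp p)), g.DefinedOver η Ω →
    IsSlowlyIncreasing (Ω : Set (Sp p)) (g.Phi η)

lemma contDiffAt_act (g : LocalGroup p) {η : ℝ} {z : Sp p × ℝ} (h : (η, z) ∈ g.dom) :
    ContDiffAt ℝ ∞ (fun z : Sp p × ℝ => (g.Xi η z.1, g.Phi η z)) z :=
  (g.smooth.contDiffAt (g.isOpen_dom.mem_nhds h)).comp z
    (contDiffAt_const.prodMk contDiffAt_id)

lemma contDiffAt_Xi (g : LocalGroup p) {η : ℝ} {x : Sp p} {u : ℝ} (h : (η, (x, u)) ∈ g.dom) :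
    ContDiffAt ℝ ∞ (g.Xi η) x :=
  ((g.contDiffAt_act h).fst).comp (f := fun y : Sp p => (y, u)) x
    (contDiffAt_id.prodMk contDiffAt_const)

lemma Xi_neg (g : LocalGroup p) {η : ℝ} {z : Sp p × ℝ} (h : (η, z) ∈ g.dom) :
    g.Xi (-η) (g.Xi η z.1) = z.1 :=
  congrArg Prod.fst (g.neg_act h)

/-- The open set `Ξ_η(Ω)`. -/
def image (g : LocalGroup p) {η : ℝ} {Ω : Opens (Sp p)} (h : g.DefinedOver η Ω) :
    Opens (Sp p) where
  carrier := g.Xi η '' Ω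
  is_open' := by
    rw [isOpen_iff_mem_nhds]
    rintro _ ⟨x, hx, rfl⟩
    have h1 : (-η, (g.Xi η x, g.Phi η (x, 0))) ∈ g.dom := g.neg_mem (h x hx 0)
    have h2 : ∀ᶠ y in 𝓝 (g.Xi η x), (-η, (y, g.Phi η (x, 0))) ∈ g.dom :=
      (Continuous.continuousAt (by fun_prop : Continuous fun y : Sp p =>
        (-η, (y, g.Phi η (x, 0))))).eventually (g.isOpen_dom.mem_nhds h1)
    have h3 : ∀ᶠ y in 𝓝 (g.Xi η x), g.Xi (-η) y ∈ (Ω : Set (Sp p)) := by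
      refine (g.contDiffAt_Xi h1).continuousAt.eventually (Ω.isOpen.mem_nhds ?_)
      rw [g.Xi_neg (h x hx 0)]
      exact hx
    filter_upwards [h2, h3] with y hy1 hy2
    refine ⟨g.Xi (-η) y, hy2, ?_⟩
    have := g.Xi_neg hy1
    rwa [neg_neg] at this

lemma mapsTo_Xi_neg (g : LocalGroup p) {η : ℝ} {Ω : Opens (Sp p)} (h : g.DefinedOver η Ω) :
    Set.MapsTo (g.Xi (-η)) (g.image h : Set (Sp p)) (Ω : Set (Sp p)) := by
  rintro _ ⟨x, hx, rfl⟩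
  rw [g.Xi_neg (h x hx 0)]
  exact hx

lemma contDiffOn_Xi_neg (g : LocalGroup p) {η : ℝ} {Ω : Opens (Sp p)} (h : g.DefinedOver η Ω) :
    ContDiffOn ℝ ∞ (g.Xi (-η)) (g.image h : Set (Sp p)) := by
  rintro _ ⟨x, hx, rfl⟩
  exact (g.contDiffAt_Xi (g.neg_mem (h x hx 0))).contDiffWithinAt

/-- The action `g_η U = cl[((Φ_η ∘ (id × u_ε)) ∘ Ξ_η⁻¹)_ε] ∈ 𝒢(Ξ_η(Ω))` of a slowly increasing
group on `U = cl[(u_ε)_ε] ∈ 𝒢(Ω)`. -/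
def act (g : LocalGroup p) (hg : g.SlowlyIncreasing) {η : ℝ} {Ω : Opens (Sp p)}
    (h : g.DefinedOver η Ω) : Colombeau Ω → Colombeau (g.image h) :=
  liftMap (fun u ε => g.actFun η (u ε))
    (fun _ hu => (hu.insert Ω.isOpen (hg η Ω h)).pullback Ω.isOpen (g.image h).isOpen
      (g.contDiffOn_Xi_neg h) (g.mapsTo_Xi_neg h))
    (fun _ _ hu hv hd => (isNegligible_insert_sub Ω.isOpen (hg η Ω h) hu hv hd).pullback Ω.isOpen
      (g.image h).isOpen (g.contDiffOn_Xi_neg h) (g.mapsTo_Xi_neg h))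

/-- The group maps smooth solutions to smooth solutions. -/
def MapsSolutions {n : ℕ} (g : LocalGroup p) (Δ : Sp p × Jet p n → ℝ) : Prop :=
  ∀ (η : ℝ) (Ω : Set (Sp p)) (f : Sp p → ℝ), IsOpen Ω → IsSmoothSolution Δ Ω f →
    (∀ x ∈ Ω, (η, (x, f x)) ∈ g.dom) → IsSmoothSolution Δ (g.Xi η '' Ω) (g.actFun η f)

/-- Every point of the variety `S_Δ = {Δ = 0}` over `M` is the jet of a local smooth solution. -/
def LocallySolvable {n : ℕ} (g : LocalGroup p) (Δ : Sp p × Jet p n → ℝ) : Prop :=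
  ∀ (x : Sp p) (v : Jet p n), (x, v (zeroIdx p n)) ∈ g.M → Δ (x, v) = 0 →
    ∃ (Ω : Set (Sp p)) (f : Sp p → ℝ), IsOpen Ω ∧ x ∈ Ω ∧ jet n f x = v ∧ IsSmoothSolution Δ Ω f

/-- The prolonged group leaves the variety `S_Δ = {Δ = 0}` invariant, i.e. `Δ(z) = 0` implies
`Δ(pr^(n) g_η (z)) = 0`. By definition, `pr^(n) g_η` sends the jet `z = (x, pr^(n) f (x))` of a
smooth function `f` to the jet of `g_η f` at `Ξ_η(x)`. -/
def PreservesVariety {n : ℕ} (g : LocalGroup p) (Δ : Sp p × Jet p n → ℝ) : Prop :=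
  ∀ (η : ℝ) (x : Sp p) (f : Sp p → ℝ), ContDiff ℝ ∞ f → (η, (x, f x)) ∈ g.dom →
    Δ (x, jet n f x) = 0 → Δ (g.Xi η x, jet n (g.actFun η f) (g.Xi η x)) = 0

/-- The group is a symmetry group of `Δ(x, u^(n)) = 0` in `𝒢`: whenever `U` is a solution in `𝒢(Ω)`
and `g_η U` is defined, `g_η U` is a solution in `𝒢(Ξ_η(Ω))`. -/
def IsGenSymmetryGroup {n : ℕ} (g : LocalGroup p) (hg : g.SlowlyIncreasing)
    {Δ : Sp p × Jet p n → ℝ} (hΔ : IsSlowlyIncreasing Set.univ Δ) : Prop :=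
  ∀ (η : ℝ) (Ω : Opens (Sp p)) (h : g.DefinedOver η Ω) (U : Colombeau Ω),
    IsGenSolution hΔ U → IsGenSolution hΔ (g.act hg h U)

end LocalGroup

end GenSymm

end

noncomputable section

namespace GenSymm

/-! ### Iterated coordinate derivatives -/

/-! Let `u` represent a solution, so that `δ_ε(x) = Δ(x, pr u_ε(x))` is negligible but in general
not zero, and the classical symmetry says nothing about the jets of `u_ε`. The isolated term makes
an exact correction possible: `Δ` is affine with slope `c` in the coordinate `u_κ`, so lowering
`u_κ` by `c⁻¹ δ_ε(x)` puts the jet exactly on the variety `Δ = 0`. This is realized at each base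
point `x` by the function `F_ε(x, y) = u_ε(y) - c⁻¹ δ_ε(x) (y - x)^κ / κ!` of `y`, whose jet at `y =
x` is the corrected one (`jet_sub_smul_jetMonom`, `sub_smul_eq_of_fderiv_eq`).

The classical symmetry applies to `F_ε(x, ·)` at `x` and gives that `Δ` vanishes at the jet of `g_η
F_ε(x, ·)` at `Ξ_η(x)` (`eq_zero_of_classical_symmetry`). Either form of the hypothesis suffices,
because the transformed jet depends on the function only through its jet (`jet_actFun_congr`), so
any function with the right jet may be substituted.

It remains to compare `g_η u_ε` with `g_η F_ε(x, ·)`. Negligibility concerns all derivatives in the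
base point too, so the correction is treated as a negligible family in the two variables `(x, y)`.
Slow increase of `Φ_η` keeps the difference negligible on the product, and differentiating in `y`
and restricting to the diagonal shows that the two jets differ negligibly (`jet_diagonal`,
`isNegligible_jet_actFun_sub`). Slow increase of `Δ` carries this over to the values of `Δ`, one of
which is identically zero. -/

/-- The coordinate derivatives of `f` along the directions in a list, the head being applied
last. -/
def coordDeriv {p : ℕ} (f : Sp p → ℝ) : List (Fin p) → Sp p → ℝ
  | [] => f
  | i :: l => fun x => fderiv ℝ (coordDeriv f l) x (EuclideanSpace.single i 1)

lemma contDiffOn_fderiv_apply {p : ℕ} {Ω : Set (Sp p)} (hΩ : IsOpen Ω) {f : Sp p → ℝ}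
    (hf : ContDiffOn ℝ ∞ f Ω) (v : Sp p) : ContDiffOn ℝ ∞ (fun x => fderiv ℝ f x v) Ω :=
  (hf.fderiv_of_isOpen hΩ (mod_cast le_top)).clm_apply contDiffOn_const

lemma contDiffOn_coordDeriv {p : ℕ} {Ω : Set (Sp p)} (hΩ : IsOpen Ω) {f : Sp p → ℝ}
    (hf : ContDiffOn ℝ ∞ f Ω) (l : List (Fin p)) : ContDiffOn ℝ ∞ (coordDeriv f l) Ω := by
  induction l with
  | nil => exact hf
  | cons i l ih => exact contDiffOn_fderiv_apply hΩ ih _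

lemma eqOn_fderiv {p : ℕ} {Ω : Set (Sp p)} (hΩ : IsOpen Ω) {f h : Sp p → ℝ}
    (hfh : Set.EqOn f h Ω) : Set.EqOn (fderiv ℝ f) (fderiv ℝ h) Ω := fun _ hx =>
  (hfh.eventuallyEq_of_mem (hΩ.mem_nhds hx)).fderiv_eq

lemma fderiv_fderiv_apply {p : ℕ} {Ω : Set (Sp p)} (hΩ : IsOpen Ω) {f : Sp p → ℝ}
    (hf : ContDiffOn ℝ ∞ f Ω) {x : Sp p} (hx : x ∈ Ω) (v w : Sp p) :
    fderiv ℝ (fun y => fderiv ℝ f y v) x w = fderiv ℝ (fderiv ℝ f) x w v := by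
  have h : DifferentiableAt ℝ (fderiv ℝ f) x :=
    ((hf.fderiv_of_isOpen hΩ (m := ∞) (mod_cast le_top)).contDiffAt
      (hΩ.mem_nhds hx)).differentiableAt (by simp)
  rw [fderiv_clm_apply h (differentiableAt_const v)]
  simp

/-- Permutations are generated by adjacent swaps, and a swap is the symmetry of the second
derivative. Hence only the multiplicities of the directions matter, which links ordered derivatives
to multi-indices. -/
lemma coordDeriv_perm {p : ℕ} {Ω : Set (Sp p)} (hΩ : IsOpen Ω) {f : Sp p → ℝ}
    (hf : ContDiffOn ℝ ∞ f Ω) {l l' : List (Fin p)} (h : l.Perm l') :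
    Set.EqOn (coordDeriv f l) (coordDeriv f l') Ω := by
  induction h with
  | nil => exact Set.eqOn_refl _ _
  | cons i _ ih =>
    intro x hx
    simp only [coordDeriv, eqOn_fderiv hΩ ih hx]
  | swap i j l =>
    intro x hx
    have hl := contDiffOn_coordDeriv hΩ hf l
    have h2 : ∀ m : ℕ, (m : WithTop ℕ∞) ≤ ∞ := fun _ => mod_cast le_top
    simp only [coordDeriv]
    rw [fderiv_fderiv_apply hΩ hl hx, fderiv_fderiv_apply hΩ hl hx]
    exact (hl.contDiffAt (hΩ.mem_nhds hx)).isSymmSndFDerivAt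
      (by
      rw [minSmoothness_of_isRCLikeNormedField]
      exact h2 2) _ _
  | trans _ _ ih1 ih2 => exact ih1.trans ih2

lemma iteratedFDeriv_single {p : ℕ} {Ω : Set (Sp p)} (hΩ : IsOpen Ω) {f : Sp p → ℝ}
    (hf : ContDiffOn ℝ ∞ f Ω) {m : ℕ} (s : Fin m → Fin p) {x : Sp p} (hx : x ∈ Ω) :
    iteratedFDeriv ℝ m f x (fun j => EuclideanSpace.single (s j) 1)
      = coordDeriv f (List.ofFn s) x := by
  induction m generalizing x with
  | zero => simp [coordDeriv]
  | succ m ih =>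
    rw [iteratedFDeriv_succ_apply_left, List.ofFn_succ]
    have hd : DifferentiableAt ℝ (iteratedFDeriv ℝ m f) x :=
      ((contDiffOn_iteratedFDeriv hΩ hf m).contDiffAt (hΩ.mem_nhds hx)).differentiableAt (by simp)
    -- The induction hypothesis is an identity on all of the open set `Ω`, not just at `x`, so it
    -- may be differentiated.
    have h1 := eqOn_fderiv hΩ (fun y hy => (ih (fun j => s j.succ) hy).symm) hx
    simp only [coordDeriv]
    rw [h1]
    have h2 := ((ContinuousMultilinearMap.apply ℝ (fun _ : Fin m => Sp p) ℝ
      (fun j : Fin m => EuclideanSpace.single (s j.succ) (1 : ℝ))).hasFDerivAt.comp x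
        hd.hasFDerivAt).fderiv
    have h3 : (⇑(ContinuousMultilinearMap.apply ℝ (fun _ : Fin m => Sp p) ℝ
        (fun j : Fin m => EuclideanSpace.single (s j.succ) (1 : ℝ))) ∘ iteratedFDeriv ℝ m f)
        = fun y => iteratedFDeriv ℝ m f y (fun j => EuclideanSpace.single (s j.succ) 1) := rfl
    rw [h3] at h2
    rw [h2]
    rfl

lemma count_ofFn {ι : Type*} [DecidableEq ι] {m : ℕ} (s : Fin m → ι) (i : ι) :
    (List.ofFn s).count i = ∑ j, if s j = i then 1 else 0 := by
  induction m with
  | zero => simp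
  | succ m ih =>
    rw [List.ofFn_succ, List.count_cons, ih, Fin.sum_univ_succ, add_comm]
    simp

/-- The list of indices that lists each `i` exactly `α i` times. -/
def idxList {p n : ℕ} (α : MultiIdx p n) : List (Fin p) :=
  List.ofFn fun j : Fin (∑ i, (α.1 i : ℕ)) => (finSigmaFinEquiv.symm j).1

lemma count_idxList {p n : ℕ} (α : MultiIdx p n) (i : Fin p) :
    (idxList α).count i = (α.1 i : ℕ) := by
  rw [idxList, count_ofFn, ← finSigmaFinEquiv.sum_comp, Fintype.sum_sigma]
  simp [Finset.sum_ite_eq']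

lemma partialD_eq_coordDeriv {p n : ℕ} {Ω : Set (Sp p)} (hΩ : IsOpen Ω) {f : Sp p → ℝ}
    (hf : ContDiffOn ℝ ∞ f Ω) (α : MultiIdx p n) {x : Sp p} (hx : x ∈ Ω) :
    partialD α f x = coordDeriv f (idxList α) x :=
  iteratedFDeriv_single hΩ hf _ hx

/-! ### Jets determine total derivatives -/

/-- A multilinear map is determined by its values on basis vectors. Such a value is a mixed partial
derivative, and sorting its directions turns it into one of the coordinates of the jet. The chain
rule for total derivatives can thus be used for jets. -/
lemma iteratedFDeriv_eq_of_jet_eq {p n : ℕ} {V W : Set (Sp p)} (hV : IsOpen V) (hW : IsOpen W)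
    {f h : Sp p → ℝ} (hf : ContDiffOn ℝ ∞ f V) (hh : ContDiffOn ℝ ∞ h W) {x : Sp p}
    (hxV : x ∈ V) (hxW : x ∈ W) (hj : jet n f x = jet n h x) {m : ℕ} (hm : m ≤ n) :
    iteratedFDeriv ℝ m f x = iteratedFDeriv ℝ m h x := by
  apply ContinuousMultilinearMap.toMultilinearMap_injective
  refine Module.Basis.ext_multilinear
    (fun _ => (EuclideanSpace.basisFun (Fin p) ℝ).toBasis) fun s => ?_
  have hsum : ∑ i, (List.ofFn s).count i = m := by
    simp only [count_ofFn]
    rw [Finset.sum_comm]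
    simp
  have hle : ∀ i, (List.ofFn s).count i ≤ m := fun i => by
    simpa using List.count_le_length (a := i) (l := List.ofFn s)
  -- The multi-index counting how often each direction occurs in `s`; its order is `m ≤ n`, so it is
  -- an admissible jet coordinate.
  let α : MultiIdx p n := ⟨fun i => ⟨(List.ofFn s).count i, by have := hle i; omega⟩, by
    simpa using hsum.trans_le hm⟩
  have hp : (List.ofFn s).Perm (idxList α) :=
    List.perm_iff_count.2 fun i => (count_idxList α i).symm
  have hα : partialD α f x = partialD α h x := congrFun hj α
  rw [partialD_eq_coordDeriv hV hf α hxV, partialD_eq_coordDeriv hW hh α hxW,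
    ← coordDeriv_perm hV hf hp hxV, ← coordDeriv_perm hW hh hp hxW,
    ← iteratedFDeriv_single hV hf s hxV, ← iteratedFDeriv_single hW hh s hxW] at hα
  simpa using hα

lemma jet_congr {p n : ℕ} {f h : Sp p → ℝ} {x : Sp p}
    (H : ∀ m ≤ n, iteratedFDeriv ℝ m f x = iteratedFDeriv ℝ m h x) : jet n f x = jet n h x := by
  funext α
  simp only [jet, partialD, H _ α.2]

lemma jet_zeroIdx {p n : ℕ} (f : Sp p → ℝ) (x : Sp p) : jet n f x (zeroIdx p n) = f x := by
  -- The order of `zeroIdx` is a sum that is only provably `0`, and the type of `v` depends on it;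
  -- generalizing the order allows the substitution.
  have h : ∀ (m : ℕ) (_ : m = 0) (v : Fin m → Sp p), iteratedFDeriv ℝ m f x v = f x := by
    rintro _ rfl v
    simp
  exact h _ (by simp [zeroIdx]) _

/-! ### Monomials and prescribed jets -/

/-- The divided power `t^k / k!`, which is zero for negative `k`. -/
def divPow (k : ℤ) (t : ℝ) : ℝ := if 0 ≤ k then t ^ k.toNat / k.toNat.factorial else 0

/-- Integer exponents, with value zero below `0`, make the rule `k ↦ k - 1` hold without exception:
the constant `k = 0` has derivative `divPow (-1) = 0`. -/
lemma hasDerivAt_divPow (k : ℤ) (t : ℝ) : HasDerivAt (divPow k) (divPow (k - 1) t) t := by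
  unfold divPow
  rcases lt_trichotomy k 0 with h | rfl | h
  · simpa [not_le.2 h, show ¬ (1 ≤ k) by omega] using hasDerivAt_const t (0 : ℝ)
  · simpa using hasDerivAt_const t (1 : ℝ)
  · obtain ⟨m, rfl⟩ : ∃ m : ℕ, k = m + 1 := ⟨(k - 1).toNat, by omega⟩
    have h1 : ((m : ℤ) + 1).toNat = m + 1 := by omega
    have h2 := (hasDerivAt_pow (m + 1) t).div_const ((m + 1).factorial : ℝ)
    simp only [show (0 : ℤ) ≤ (m : ℤ) + 1 by omega, if_true, h1, add_sub_cancel_right,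
      Int.natCast_nonneg, Int.toNat_natCast]
    refine h2.congr_deriv ?_
    rw [Nat.factorial_succ]
    push_cast
    have : (m.factorial : ℝ) ≠ 0 := by positivity
    field_simp

lemma contDiff_divPow (k : ℤ) : ContDiff ℝ ∞ (divPow k) := by
  unfold divPow
  split_ifs
  · fun_prop
  · exact contDiff_const

lemma divPow_zero (k : ℤ) : divPow k 0 = if k = 0 then 1 else 0 := by
  unfold divPow
  rcases lt_trichotomy k 0 with h | rfl | h
  · simp [not_le.2 h, h.ne]
  · simp
  · simp [h.le, h.ne', show ¬ (k ≤ 0) by omega]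

/-- The normalized monomial `y^k / k!`. -/
def monom {p : ℕ} (k : Fin p → ℤ) (y : Sp p) : ℝ := ∏ i, divPow (k i) (y i)

lemma contDiff_coord {p : ℕ} (i : Fin p) : ContDiff ℝ ∞ (fun y : Sp p => y i) :=
  (EuclideanSpace.proj (𝕜 := ℝ) i).contDiff

lemma contDiff_monom {p : ℕ} (k : Fin p → ℤ) : ContDiff ℝ ∞ (monom k) :=
  contDiff_prod fun i _ => (contDiff_divPow (k i)).comp (contDiff_coord i)

lemma fderiv_monom {p : ℕ} (k : Fin p → ℤ) (y : Sp p) (i : Fin p) :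
    fderiv ℝ (monom k) y (EuclideanSpace.single i 1) = monom (k - Pi.single i 1) y := by
  have h : ∀ j ∈ (Finset.univ : Finset (Fin p)), HasFDerivAt (fun y : Sp p => divPow (k j) (y j))
      (divPow (k j - 1) (y j) • (EuclideanSpace.proj (𝕜 := ℝ) j : Sp p →L[ℝ] ℝ)) y := fun j _ =>
    HasDerivAt.comp_hasFDerivAt (h₂ := divPow (k j)) (f := fun y : Sp p => y j) y
      (hasDerivAt_divPow (k j) (y j)) (EuclideanSpace.proj (𝕜 := ℝ) j : Sp p →L[ℝ] ℝ).hasFDerivAt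
  have h1 : HasFDerivAt (monom k) _ y := HasFDerivAt.finsetProd h
  rw [h1.fderiv, _root_.sum_apply, Finset.sum_eq_single i]
  · unfold monom
    rw [← Finset.mul_prod_erase Finset.univ _ (Finset.mem_univ i)]
    simp only [smul_apply, smul_eq_mul, Pi.sub_apply, Pi.single_eq_same, PiLp.proj_apply,
      PiLp.single_apply, if_true, mul_one]
    rw [mul_comm]
    congr 1
    refine Finset.prod_congr rfl fun j hj => ?_
    rw [Pi.single_eq_of_ne (Finset.ne_of_mem_erase hj), sub_zero]
  · intro j _ hj
    simp [hj]
  · simp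

/-- Each differentiation lowers one exponent by one, with no numerical factor thanks to the divided
powers; overdifferentiated monomials vanish automatically. -/
lemma coordDeriv_monom {p : ℕ} (k : Fin p → ℤ) (l : List (Fin p)) :
    coordDeriv (monom k) l = monom fun i => k i - l.count i := by
  induction l with
  | nil => simp [coordDeriv]
  | cons i l ih =>
    funext y
    simp only [coordDeriv]
    rw [ih, fderiv_monom]
    congr 1
    funext j
    rw [List.count_cons]
    by_cases h : j = i
    · subst h
      simp
      ring
    · simp [h, Ne.symm h]

lemma monom_zero {p : ℕ} (k : Fin p → ℤ) : monom k 0 = if k = 0 then 1 else 0 := by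
  unfold monom
  simp only [PiLp.zero_apply, divPow_zero]
  rw [Fintype.prod_ite_zero]
  simp [funext_iff]

/-- The polynomial centred at `x` whose jet at `x` is the unit vector of index `κ`. -/
def jetMonom {p n : ℕ} (κ : MultiIdx p n) (y : Sp p) : ℝ := monom (fun i => ((κ.1 i : ℕ) : ℤ)) y

lemma contDiff_jetMonom {p n : ℕ} (κ : MultiIdx p n) : ContDiff ℝ ∞ (jetMonom κ) :=
  contDiff_monom _

/-- After translation to the origin, `∂^α` gives the divided monomial of exponent `κ - α`, which at
`0` equals `1` if `α = κ` and `0` otherwise. -/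
lemma jet_jetMonom {p n : ℕ} (κ : MultiIdx p n) (x : Sp p) :
    jet n (fun y => jetMonom κ (y - x)) x = Pi.single κ 1 := by
  funext α
  have h : partialD α (fun y => jetMonom κ (y - x)) x = partialD α (jetMonom κ) 0 := by
    simp only [partialD]
    rw [iteratedFDeriv_comp_sub, sub_self]
  rw [jet, h, partialD_eq_coordDeriv isOpen_univ (contDiff_jetMonom κ).contDiffOn α
    (Set.mem_univ _)]
  unfold jetMonom
  rw [coordDeriv_monom, monom_zero, Pi.single_apply]
  simp only [count_idxList]
  congr 1
  simp only [eq_iff_iff]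
  constructor
  · intro h
    refine Subtype.ext (funext fun i => Fin.ext ?_)
    have := congrFun h i
    simp only [Pi.zero_apply] at this
    omega
  · rintro rfl
    funext i
    simp

/-- The Taylor polynomial with the prescribed coefficients does it. -/
lemma exists_contDiff_jet_eq {p n : ℕ} (x : Sp p) (v : Jet p n) :
    ∃ f : Sp p → ℝ, ContDiff ℝ ∞ f ∧ jet n f x = v := by
  have hs : ∀ κ : MultiIdx p n, ContDiff ℝ ∞ (fun y => v κ • jetMonom κ (y - x)) := fun κ =>
    ((contDiff_jetMonom κ).comp (contDiff_id.sub contDiff_const)).const_smul _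
  refine ⟨fun y => ∑ κ, v κ • jetMonom κ (y - x), ContDiff.sum fun κ _ => hs κ, ?_⟩
  funext α
  have h : ∀ κ, partialD α (fun y => v κ • jetMonom κ (y - x)) x
      = v κ * (Pi.single κ (1 : ℝ) : Jet p n) α := fun κ => by
    have h1 : ContDiff ℝ ∞ (fun y => jetMonom κ (y - x)) :=
      (contDiff_jetMonom κ).comp (contDiff_id.sub contDiff_const)
    rw [← jet_jetMonom κ x]
    simp only [partialD, jet]
    rw [iteratedFDeriv_const_smul_apply' (h1.contDiffAt.of_le (mod_cast le_top))]
    rfl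
  simp only [jet, partialD]
  rw [iteratedFDeriv_fun_sum_apply fun κ _ => (hs κ).contDiffAt.of_le (mod_cast le_top),
    _root_.sum_apply]
  refine (Finset.sum_congr rfl fun κ _ => h κ).trans ?_
  simp [Pi.single_apply]

end GenSymm

namespace GenSymm

/-! ### Total derivatives of compositions depend only on total derivatives -/

section Composition

variable {E F G : Type} [NormedAddCommGroup E] [NormedSpace ℝ E]
  [NormedAddCommGroup F] [NormedSpace ℝ F] [NormedAddCommGroup G] [NormedSpace ℝ G]

/-- In Faà di Bruno's formula of order `m`, both the number of blocks of a partition and the sizes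
of its blocks are at most `m`. -/
lemma taylorComp_congr {q q' : FormalMultilinearSeries ℝ F G} {r r' : FormalMultilinearSeries ℝ E F}
    {m : ℕ} (hq : ∀ i ≤ m, q i = q' i) (hr : ∀ i ≤ m, r i = r' i) :
    q.taylorComp r m = q'.taylorComp r' m := by
  unfold FormalMultilinearSeries.taylorComp
  refine Finset.sum_congr rfl fun c _ => ?_
  ext v
  rw [FormalMultilinearSeries.compAlongOrderedFinpartition_apply,
    FormalMultilinearSeries.compAlongOrderedFinpartition_apply, hq _ c.length_le]
  congr 2
  funext j
  exact hr _ (c.partSize_le j)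

lemma iteratedFDeriv_comp_congr {g g' : F → G} {f f' : E → F} {x : E} {y : F} {n : ℕ}
    (hy : f x = y) (hy' : f' x = y)
    (hg : ContDiffAt ℝ ∞ g y) (hg' : ContDiffAt ℝ ∞ g' y)
    (hf : ContDiffAt ℝ ∞ f x) (hf' : ContDiffAt ℝ ∞ f' x)
    (Hg : ∀ m ≤ n, iteratedFDeriv ℝ m g y = iteratedFDeriv ℝ m g' y)
    (Hf : ∀ m ≤ n, iteratedFDeriv ℝ m f x = iteratedFDeriv ℝ m f' x) {m : ℕ} (hm : m ≤ n) :
    iteratedFDeriv ℝ m (g ∘ f) x = iteratedFDeriv ℝ m (g' ∘ f') x := by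
  subst hy
  rw [iteratedFDeriv_comp (n := ∞) hg hf (mod_cast le_top),
    iteratedFDeriv_comp (n := ∞) (hy' ▸ hg') hf' (mod_cast le_top), hy']
  exact taylorComp_congr (fun i hi => Hg i (hi.trans hm)) (fun i hi => Hf i (hi.trans hm))

lemma iteratedFDeriv_graph_congr {f f' : E → F} {x : E} {n : ℕ}
    (hf : ContDiffAt ℝ ∞ f x) (hf' : ContDiffAt ℝ ∞ f' x)
    (Hf : ∀ m ≤ n, iteratedFDeriv ℝ m f x = iteratedFDeriv ℝ m f' x) {m : ℕ} (hm : m ≤ n) :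
    iteratedFDeriv ℝ m (fun y => (y, f y)) x = iteratedFDeriv ℝ m (fun y => (y, f' y)) x := by
  rw [iteratedFDeriv_prodMk (n := ∞) (f := fun y => y) contDiffAt_id hf (mod_cast le_top),
    iteratedFDeriv_prodMk (n := ∞) (f := fun y => y) contDiffAt_id hf' (mod_cast le_top), Hf m hm]

/-- Iterated derivatives of a slice of a function of two variables. -/
lemma iteratedFDeriv_slice {O : Set (E × F)} (hO : IsOpen O) {W : E × F → G}
    (hW : ContDiffOn ℝ ∞ W O) {x : E} {y : F} (h : (x, y) ∈ O) (m : ℕ) :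
    iteratedFDeriv ℝ m (fun y => W (x, y)) y
      = (iteratedFDeriv ℝ m W (x, y)).compContinuousLinearMap
          fun _ => ContinuousLinearMap.inr ℝ E F := by
  -- The slice map `y ↦ (x, y)` is the linear map `inr` followed by the translation by `(x, 0)`;
  -- each factor has a simple rule for iterated derivatives.
  have hc : Continuous fun z : E × F => z + (x, (0 : F)) := by fun_prop
  have hO' : IsOpen ((fun z : E × F => z + (x, (0 : F))) ⁻¹' O) := hO.preimage hc
  have hW' : ContDiffOn ℝ ∞ (fun z => W (z + (x, (0 : F))))
      ((fun z : E × F => z + (x, (0 : F))) ⁻¹' O) :=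
    hW.comp (contDiff_id.add contDiff_const).contDiffOn fun _ hz => hz
  have hy : ContinuousLinearMap.inr ℝ E F y ∈ (fun z : E × F => z + (x, (0 : F))) ⁻¹' O := by
    simpa using h
  have ho : IsOpen (ContinuousLinearMap.inr ℝ E F ⁻¹'
      ((fun z : E × F => z + (x, (0 : F))) ⁻¹' O)) :=
    hO'.preimage (ContinuousLinearMap.inr ℝ E F).continuous
  have key := (ContinuousLinearMap.inr ℝ E F).iteratedFDerivWithin_comp_right hW'
    hO'.uniqueDiffOn ho.uniqueDiffOn hy (i := m) (mod_cast le_top)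
  rw [iteratedFDerivWithin_of_isOpen _ ho hy, iteratedFDerivWithin_of_isOpen _ hO' hy,
    iteratedFDeriv_comp_add_right] at key
  have e1 : (fun z => W (z + (x, (0 : F)))) ∘ ContinuousLinearMap.inr ℝ E F
      = fun y => W (x, y) := by
    funext z
    simp
  rw [e1] at key
  simpa using key

/-- A slowly increasing function remains so when dummy variables are added. -/
lemma IsSlowlyIncreasing.comp_snd {O : Set (E × F)} {Ω : Set F} (hΩ : IsOpen Ω)
    (hOΩ : Set.MapsTo Prod.snd O Ω) {Φ : F × ℝ → G} (hΦ : IsSlowlyIncreasing Ω Φ) :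
    IsSlowlyIncreasing O (fun z : (E × F) × ℝ => Φ (z.1.2, z.2)) := by
  let L : (E × F) × ℝ →L[ℝ] F × ℝ :=
    (ContinuousLinearMap.snd ℝ E F).prodMap (ContinuousLinearMap.id ℝ ℝ)
  have hm : Set.MapsTo L (O ×ˢ Set.univ) (Ω ×ˢ Set.univ) := fun z hz => ⟨hOΩ hz.1, trivial⟩
  have hU : IsOpen (Ω ×ˢ (Set.univ : Set ℝ)) := hΩ.prod isOpen_univ
  have hU' : IsOpen (L ⁻¹' (Ω ×ˢ (Set.univ : Set ℝ))) := hU.preimage L.continuous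
  refine ⟨hΦ.1.comp L.contDiff.contDiffOn hm, fun K hK hKc k => ?_⟩
  obtain ⟨N, C, hC⟩ := hΦ.2 (Prod.snd '' K) ((Set.image_mono hK).trans hOΩ.image_subset)
    (hKc.image continuous_snd) k
  -- Composition with the linear map `L` costs one factor `‖L‖` per derivative; the exponent `N` is
  -- unchanged because `L` leaves the variable `w` alone.
  refine ⟨N, C * ‖L‖ ^ k, fun x hx w => ?_⟩
  have hz : L (x, w) ∈ Ω ×ˢ (Set.univ : Set ℝ) := hm ⟨hK hx, trivial⟩
  have key := L.iteratedFDerivWithin_comp_right hΦ.1 hU.uniqueDiffOn hU'.uniqueDiffOn hz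
    (i := k) (mod_cast le_top)
  rw [iteratedFDerivWithin_of_isOpen _ hU' hz, iteratedFDerivWithin_of_isOpen _ hU hz] at key
  have e1 : (fun z : (E × F) × ℝ => Φ (z.1.2, z.2)) = Φ ∘ L := rfl
  rw [e1, key]
  refine (ContinuousMultilinearMap.norm_compContinuousLinearMap_le _ _).trans ?_
  rw [Finset.prod_const, Finset.card_univ, Fintype.card_fin]
  have := hC x.2 ⟨x, hx, rfl⟩ w
  calc _ ≤ C * (1 + ‖w‖) ^ N * ‖L‖ ^ k := by gcongr; exact this
    _ = _ := by ring

end Composition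

/-! ### Families in two variables: jets along the diagonal -/

/-- The jets of the slices of a negligible family in two variables are negligible along the
diagonal. -/
lemma IsNegligible.jet_diagonal {p : ℕ} (n : ℕ) {Ω : Set (Sp p)} (hΩ : IsOpen Ω)
    {W : Par → Sp p × Sp p → ℝ} (hW : IsNegligible (Ω ×ˢ Ω) W) :
    IsNegligible Ω (fun ε x => GenSymm.jet n (fun y => W ε (x, y)) x) := by
  have hO : IsOpen (Ω ×ˢ Ω) := hΩ.prod hΩ
  have h1 : ∀ m : ℕ, IsNegligible (Ω ×ˢ Ω) (fun ε => iteratedFDeriv ℝ m (W ε)) := fun m =>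
    ⟨fun ε x hx => (((hW.1 ε).contDiffAt (hO.mem_nhds hx)).iteratedFDeriv_right (m := ∞) (i := m)
      (by norm_cast)).contDiffWithinAt, fun K hK hKc k q =>
      growth_iteratedFDeriv m k (hW.2 K hK hKc (k + m) q)⟩
  -- A derivative in the second variable is a total derivative on the product evaluated at
  -- directions `inr`; the pullback along `x ↦ (x, x)` restricts it to the diagonal.
  have h2 : ∀ α : MultiIdx p n, IsNegligible Ω (fun ε x =>
      ContinuousLinearMap.single ℝ (fun _ : MultiIdx p n => ℝ) α
        (iteratedFDeriv ℝ (∑ i, (α.1 i : ℕ)) (W ε) (x, x)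
          (fun j => ContinuousLinearMap.inr ℝ (Sp p) (Sp p) (dirs α j)))) := fun α =>
    (((h1 _).clm hO (ContinuousMultilinearMap.apply ℝ
      (fun _ : Fin (∑ i, (α.1 i : ℕ)) => Sp p × Sp p) ℝ
        (fun j => ContinuousLinearMap.inr ℝ (Sp p) (Sp p) (dirs α j)))).pullback hO hΩ
        (contDiff_id.prodMk contDiff_id).contDiffOn (fun x hx => ⟨hx, hx⟩)).clm hΩ _
  have h0 : IsNegligible Ω (fun (_ : Par) (_ : Sp p) => (0 : Jet p n)) := by
    have := (hW.clm hO (0 : ℝ →L[ℝ] Jet p n)).pullback hO hΩ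
      (contDiff_id.prodMk contDiff_id).contDiffOn (fun x hx => ⟨hx, hx⟩)
    simpa using this
  have h3 : ∀ s : Finset (MultiIdx p n), IsNegligible Ω (fun ε x => ∑ α ∈ s,
      ContinuousLinearMap.single ℝ (fun _ : MultiIdx p n => ℝ) α
        (iteratedFDeriv ℝ (∑ i, (α.1 i : ℕ)) (W ε) (x, x)
          (fun j => ContinuousLinearMap.inr ℝ (Sp p) (Sp p) (dirs α j)))) := by
    classical
    intro s
    induction s using Finset.induction_on with
    | empty => simpa using h0
    | insert α s hα ih =>
      simp only [Finset.sum_insert hα]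
      exact (h2 α).add hΩ ih
  refine (h3 Finset.univ).congr hΩ fun ε x hx => ?_
  dsimp only
  rw [jet_eq_sum]
  refine Finset.sum_congr rfl fun α _ => ?_
  congr 1
  simp only [partialD]
  rw [iteratedFDeriv_slice hO (hW.1 ε) ⟨hx, hx⟩]
  rfl

end GenSymm

/-! ### Prolonged action and classical invariance of the variety -/

namespace GenSymm

namespace LocalGroup

variable {p : ℕ}

/-- The jet of `g_η f` at `Ξ_η(x)` depends on `f` only through its jet at `x`. -/
lemma jet_actFun_congr {n : ℕ} (g : LocalGroup p) {η : ℝ} {x : Sp p} {V W : Set (Sp p)}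
    (hV : IsOpen V) (hW : IsOpen W) {f h : Sp p → ℝ} (hf : ContDiffOn ℝ ∞ f V)
    (hh : ContDiffOn ℝ ∞ h W) (hxV : x ∈ V) (hxW : x ∈ W) (hj : jet n f x = jet n h x)
    (hd : (η, (x, f x)) ∈ g.dom) :
    jet n (g.actFun η f) (g.Xi η x) = jet n (g.actFun η h) (g.Xi η x) := by
  have hx : g.Xi (-η) (g.Xi η x) = x := g.Xi_neg hd
  have hfh : h x = f x := by rw [← jet_zeroIdx (n := n) f, hj, jet_zeroIdx]
  have cX : ContDiffAt ℝ ∞ (g.Xi (-η)) (g.Xi η x) := g.contDiffAt_Xi (g.neg_mem hd)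
  have cP : ContDiffAt ℝ ∞ (g.Phi η) (x, f x) := (g.contDiffAt_act hd).snd
  have cf : ContDiffAt ℝ ∞ f x := hf.contDiffAt (hV.mem_nhds hxV)
  have ch : ContDiffAt ℝ ∞ h x := hh.contDiffAt (hW.mem_nhds hxW)
  have c1 : ContDiffAt ℝ ∞ (fun y => (y, f y)) x := contDiffAt_id.prodMk cf
  have c2 : ContDiffAt ℝ ∞ (fun y => (y, h y)) x := contDiffAt_id.prodMk ch
  have d1 : ContDiffAt ℝ ∞ (g.Phi η ∘ fun y => (y, f y)) x := cP.comp x c1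
  have d2 : ContDiffAt ℝ ∞ (g.Phi η ∘ fun y => (y, h y)) x :=
    ContDiffAt.comp x (hfh.symm ▸ cP) c2
  refine jet_congr fun m hm => ?_
  -- The function `g_η f` is `Φ_η ∘ (id × f) ∘ Ξ_{-η}`; the outer and inner maps are the same for
  -- `f` and `h`, so two uses of the chain rule reduce the claim to the graphs.
  refine iteratedFDeriv_comp_congr (g := g.Phi η ∘ fun y => (y, f y))
    (g' := g.Phi η ∘ fun y => (y, h y)) (f := g.Xi (-η)) (f' := g.Xi (-η)) hx hx d1 d2 cX cX
    (fun i hi => ?_) (fun _ _ => rfl) hm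
  refine iteratedFDeriv_comp_congr (f := fun y => (y, f y)) (f' := fun y => (y, h y)) rfl
    (congrArg (Prod.mk x) hfh) cP cP c1 c2 (fun _ _ => rfl)
    (fun j hj' => ?_) hi
  exact iteratedFDeriv_graph_congr cf ch
    (fun k hk => iteratedFDeriv_eq_of_jet_eq hV hW hf hh hxV hxW hj hk) hj'

/-- Both notions of classical symmetry give invariance of the variety along jets of locally defined
smooth functions. -/
lemma eq_zero_of_classical_symmetry {n : ℕ} (g : LocalGroup p) {Δ : Sp p × Jet p n → ℝ}
    (hsymm : g.PreservesVariety Δ ∨ (g.LocallySolvable Δ ∧ g.MapsSolutions Δ))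
    {η : ℝ} {x : Sp p} {V : Set (Sp p)} (hV : IsOpen V) (hx : x ∈ V) {f : Sp p → ℝ}
    (hf : ContDiffOn ℝ ∞ f V) (hd : (η, (x, f x)) ∈ g.dom) (h0 : Δ (x, jet n f x) = 0) :
    Δ (g.Xi η x, jet n (g.actFun η f) (g.Xi η x)) = 0 := by
  rcases hsymm with hs | ⟨hl, hm⟩
  -- Invariance of the variety is formulated for globally smooth functions, so the local `f` is
  -- replaced by a polynomial with the same jet.
  · obtain ⟨h, hh, hj⟩ := exists_contDiff_jet_eq x (jet n f x)
    have hfh : h x = f x := by rw [← jet_zeroIdx (n := n) h, hj, jet_zeroIdx]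
    rw [g.jet_actFun_congr hV isOpen_univ hf hh.contDiffOn hx trivial hj.symm hd]
    exact hs η x h hh (hfh ▸ hd) (hj ▸ h0)
  · obtain ⟨W, h, hW, hxW, hj, hsol⟩ := hl x (jet n f x)
      (by rw [jet_zeroIdx]; exact g.mem_of_dom hd) h0
    have hfh : h x = f x := by rw [← jet_zeroIdx (n := n) h, hj, jet_zeroIdx]
    -- The solution `h` must have its whole graph in the domain of `g_η`; this holds after shrinking
    -- `W` to an open neighbourhood of `x`.
    have hc : ContinuousOn (fun y => (η, (y, h y))) W :=
      continuousOn_const.prodMk (continuousOn_id.prodMk hsol.1.continuousOn)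
    have hW' := hc.isOpen_inter_preimage hW g.isOpen_dom
    rw [g.jet_actFun_congr hV hW hf hsol.1 hx hxW hj.symm hd]
    refine (hm η _ h hW' ⟨hsol.1.mono Set.inter_subset_left, fun y hy => hsol.2 y hy.1⟩
      fun y hy => hy.2).2 _ ⟨x, ⟨hxW, ?_⟩, rfl⟩
    change (η, (x, h x)) ∈ g.dom
    rwa [hfh]

end LocalGroup

/-! ### Correcting a jet in the direction of the isolated term -/

/-- A function with constant directional derivative along a line is affine on that line. -/
lemma sub_smul_eq_of_fderiv_eq {p n : ℕ} {Δ : Sp p × Jet p n → ℝ} (hΔ : ContDiff ℝ ∞ Δ)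
    {x : Sp p} {v e : Jet p n} {c : ℝ}
    (h : ∀ t : ℝ, fderiv ℝ Δ (x, v - t • e) (0, e) = c) (t : ℝ) :
    Δ (x, v - t • e) = Δ (x, v) - t * c := by
  have hd : ∀ t : ℝ, HasDerivAt (fun t : ℝ => Δ (x, v - t • e) + t * c) 0 t := fun t => by
    have h1 : HasDerivAt (fun t : ℝ => (x, v - t • e)) ((0 : Sp p), -e) t := by
      have := (hasDerivAt_const t x).prodMk
        ((hasDerivAt_const t v).sub ((hasDerivAt_id t).smul_const e))
      simpa using this
    have h2 := ((hΔ.differentiable (by simp)) (x, v - t • e)).hasFDerivAt.comp_hasDerivAt t h1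
    have h3 := h2.add ((hasDerivAt_id t).mul_const c)
    refine h3.congr_deriv ?_
    have : ((0 : Sp p), -e) = -((0 : Sp p), e) := by simp
    rw [this, map_neg, h t]
    ring
  have := is_const_of_deriv_eq_zero (fun t => (hd t).differentiableAt) (fun t => (hd t).deriv) t 0
  simp only [zero_smul, sub_zero, zero_mul, add_zero] at this
  linarith

lemma cl_eq_zero_iff {p : ℕ} {Ω : Opens (Sp p)} {u : Par → Sp p → ℝ}
    (hu : IsModerate (Ω : Set (Sp p)) u) :
    cl u hu = 0 ↔ IsNegligible (Ω : Set (Sp p)) u :=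
  Ideal.Quotient.eq_zero_iff_mem

lemma IsSlowlyIncreasing.mono {E F H : Type} [NormedAddCommGroup E] [NormedSpace ℝ E]
    [NormedAddCommGroup F] [NormedSpace ℝ F] [NormedAddCommGroup H] [NormedSpace ℝ H]
    {Ω Ω' : Set E} {Φ : E × H → F} (h : IsSlowlyIncreasing Ω' Φ) (hΩ : Ω ⊆ Ω') :
    IsSlowlyIncreasing Ω Φ :=
  ⟨h.1.mono (Set.prod_mono hΩ subset_rfl), fun K hK => h.2 K (hK.trans hΩ)⟩

lemma jet_sub {p n : ℕ} {V : Set (Sp p)} (hV : IsOpen V) {f h : Sp p → ℝ}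
    (hf : ContDiffOn ℝ ∞ f V) (hh : ContDiffOn ℝ ∞ h V) {x : Sp p} (hx : x ∈ V) :
    jet n (fun y => f y - h y) x = jet n f x - jet n h x := by
  funext α
  simp only [jet, partialD, Pi.sub_apply]
  rw [fun_iteratedFDeriv_sub_apply ((hf.contDiffAt (hV.mem_nhds hx)).of_le (mod_cast le_top))
    ((hh.contDiffAt (hV.mem_nhds hx)).of_le (mod_cast le_top))]
  rfl

lemma jet_sub_smul_jetMonom {p n : ℕ} (κ : MultiIdx p n) {V : Set (Sp p)} (hV : IsOpen V)
    {f : Sp p → ℝ} (hf : ContDiffOn ℝ ∞ f V) {x : Sp p} (hx : x ∈ V) (a : ℝ) :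
    jet n (fun y => f y - a * jetMonom κ (y - x)) x = jet n f x - a • Pi.single κ 1 := by
  have h1 : ContDiff ℝ ∞ (fun y => jetMonom κ (y - x)) :=
    (contDiff_jetMonom κ).comp (contDiff_id.sub contDiff_const)
  rw [jet_sub hV hf (contDiff_const.mul h1).contDiffOn hx, ← jet_jetMonom κ x]
  congr 1
  funext α
  change iteratedFDeriv ℝ _ (fun y => a • jetMonom κ (y - x)) x _ = _
  rw [iteratedFDeriv_const_smul_apply' (a := a) (h1.contDiffAt.of_le (mod_cast le_top))]
  rfl

/-! ### Transformed jets under negligible perturbations depending on the base point -/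

namespace LocalGroup

variable {p : ℕ}

/-- If the functions `F_ε(x, ·)` differ from `u_ε` by a negligible family in two variables, then
the jets of `g_η u_ε` differ negligibly from those of `g_η F_ε(x, ·)` at `Ξ_η(x)`. -/
lemma isNegligible_jet_actFun_sub (n : ℕ) (g : LocalGroup p) (hg : g.SlowlyIncreasing) {η : ℝ}
    {Ω : Opens (Sp p)} (h : g.DefinedOver η Ω) {u : Par → Sp p → ℝ}
    (hu : IsModerate (Ω : Set (Sp p)) u) {R : Par → Sp p × Sp p → ℝ}
    (hR : IsNegligible ((Ω : Set (Sp p)) ×ˢ (Ω : Set (Sp p))) R) :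
    IsNegligible (g.image h : Set (Sp p)) (fun ε y => jet n (g.actFun η (u ε)) y
      - jet n (g.actFun η fun z => u ε z - R ε (g.Xi (-η) y, z)) y) := by
  have hO : IsOpen ((Ω : Set (Sp p)) ×ˢ (Ω : Set (Sp p))) := Ω.isOpen.prod Ω.isOpen
  have hI := (g.image h).isOpen
  have hm := g.mapsTo_Xi_neg h
  have hX := g.contDiffOn_Xi_neg h
  have hΦ := hg η Ω h
  -- The base point becomes a dummy variable, so that `Φ_η(y, u_ε(y))` and `Φ_η(y, u_ε(y) - R_ε(x,
  -- y))` can be compared on the product by a single insertion.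
  have hΨ := hΦ.comp_snd (O := (Ω : Set (Sp p)) ×ˢ (Ω : Set (Sp p))) Ω.isOpen fun z hz => hz.2
  have hu2 : IsModerate ((Ω : Set (Sp p)) ×ˢ (Ω : Set (Sp p))) (fun ε z => u ε z.2) :=
    hu.pullback Ω.isOpen hO contDiff_snd.contDiffOn fun z hz => hz.2
  have hF2 : IsModerate ((Ω : Set (Sp p)) ×ˢ (Ω : Set (Sp p))) (fun ε z => u ε z.2 - R ε z) := by
    simpa [sub_eq_add_neg] using hu2.add hO (hR.isModerate.clm hO (-ContinuousLinearMap.id ℝ ℝ))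
  have hN := isNegligible_insert_sub hO hΨ hu2 hF2 (by simpa using hR)
  have hXX : ContDiffOn ℝ ∞ (fun z : Sp p × Sp p => (g.Xi (-η) z.1, g.Xi (-η) z.2))
      ((g.image h : Set (Sp p)) ×ˢ (g.image h : Set (Sp p))) :=
    (hX.comp contDiff_fst.contDiffOn fun z hz => hz.1).prodMk
      (hX.comp contDiff_snd.contDiffOn fun z hz => hz.2)
  -- Both variables are transported by `Ξ_{-η}`, the first serving as a frozen parameter; the jet is
  -- taken in the second alone, and only afterwards are the two identified.
  have hD := (hN.pullback hO (hI.prod hI) hXX fun z hz => ⟨hm hz.1, hm hz.2⟩).jet_diagonal n hI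
  refine hD.congr hI fun ε y hy => ?_
  have c1 : ContDiffOn ℝ ∞ (g.actFun η (u ε)) (g.image h : Set (Sp p)) :=
    (((hu.insert Ω.isOpen hΦ).1 ε).comp hX hm)
  have c2 : ContDiffOn ℝ ∞ (g.actFun η fun z => u ε z - R ε (g.Xi (-η) y, z))
      (g.image h : Set (Sp p)) :=
    (((hF2.insert hO hΨ).1 ε).comp (contDiffOn_const.prodMk hX)
      fun z hz => ⟨hm hy, hm hz⟩)
  exact jet_sub hI c1 c2 hy

end LocalGroup

end GenSymm

end

/-! ### The symmetry theorem -/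

/-- If some jet coordinate `u_κ`, `|κ| ≤ n`, occurs in `Δ` as an isolated term with constant
coefficient `c ≠ 0`, then a slowly increasing projectable symmetry group of `Δ(x, u^(n)) = 0` is a
symmetry group of that equation in the Colombeau algebra. -/
theorem theorem3p8 (p n : ℕ) (Δ : GenSymm.Sp p × GenSymm.Jet p n → ℝ)
    (hΔ : GenSymm.IsSlowlyIncreasing Set.univ Δ)
    (g : GenSymm.LocalGroup p) (hg : g.SlowlyIncreasing)
    (hsymm : g.PreservesVariety Δ ∨ (g.LocallySolvable Δ ∧ g.MapsSolutions Δ))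
    (κ : GenSymm.MultiIdx p n) (c : ℝ) (hc : c ≠ 0)
    (hκ : ∀ (x : GenSymm.Sp p) (v : GenSymm.Jet p n), (x, v (GenSymm.zeroIdx p n)) ∈ g.M →
      fderiv ℝ Δ (x, v) (0, Pi.single κ 1) = c) :
    g.IsGenSymmetryGroup hg hΔ := by
  intro η Ω h U hU
  obtain ⟨⟨u, hu⟩, rfl⟩ := Ideal.Quotient.mk_surjective U
  replace hu : GenSymm.IsModerate (Ω : Set (GenSymm.Sp p)) u := hu
  have hδ : GenSymm.IsNegligible (Ω : Set (GenSymm.Sp p))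
      (fun ε x => Δ (x, GenSymm.jet n (u ε) x)) := (GenSymm.cl_eq_zero_iff _).1 hU
  have hI := (g.image h).isOpen
  have hO : IsOpen ((Ω : Set (GenSymm.Sp p)) ×ˢ (Ω : Set (GenSymm.Sp p))) :=
    Ω.isOpen.prod Ω.isOpen
  have hΔc : ContDiff ℝ ∞ Δ := by
    have := hΔ.1
    rwa [Set.univ_prod_univ, contDiffOn_univ] at this
  have hmon : GenSymm.IsModerate ((Ω : Set (GenSymm.Sp p)) ×ˢ (Ω : Set (GenSymm.Sp p)))
      (fun _ z => GenSymm.jetMonom κ (z.2 - z.1)) :=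
    GenSymm.isModerate_const hO
      ((GenSymm.contDiff_jetMonom κ).comp (contDiff_snd.sub contDiff_fst)).contDiffOn
  -- The correction `c⁻¹ δ_ε(x) (y - x)^κ / κ!`: a negligible factor in `x` times a fixed smooth
  -- function of `(x, y)`.
  have hR : GenSymm.IsNegligible ((Ω : Set (GenSymm.Sp p)) ×ˢ (Ω : Set (GenSymm.Sp p)))
      (fun ε z => (c⁻¹ * Δ (z.1, GenSymm.jet n (u ε) z.1)) *
        GenSymm.jetMonom κ (z.2 - z.1)) :=
    ((hδ.clm Ω.isOpen (ContinuousLinearMap.mul ℝ ℝ c⁻¹)).pullback Ω.isOpen hO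
      contDiff_fst.contDiffOn fun z hz => hz.1).bilin_left hO (ContinuousLinearMap.mul ℝ ℝ) hmon
  have hd := g.isNegligible_jet_actFun_sub n hg h hu hR
  have hv : GenSymm.IsModerate (g.image h : Set (GenSymm.Sp p))
      (fun ε => g.actFun η (u ε)) :=
    (hu.insert Ω.isOpen (hg η Ω h)).pullback Ω.isOpen hI (g.contDiffOn_Xi_neg h)
      (g.mapsTo_Xi_neg h)
  have hw := hv.jet n hI
  have hw' : GenSymm.IsModerate (g.image h : Set (GenSymm.Sp p)) (fun ε y =>
      GenSymm.jet n (g.actFun η fun z => u ε z - (c⁻¹ * Δ (g.Xi (-η) y,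
        GenSymm.jet n (u ε) (g.Xi (-η) y))) * GenSymm.jetMonom κ (z - g.Xi (-η) y)) y) := by
    -- The jets of the corrected functions are moderate as the jets of `g_η u_ε` minus a negligible
    -- family.
    simpa using hw.add hI (hd.isModerate.clm hI (-ContinuousLinearMap.id ℝ (GenSymm.Jet p n)))
  have key := GenSymm.isNegligible_insert_sub hI (hΔ.mono (Set.subset_univ _)) hw hw' hd
  refine (GenSymm.cl_eq_zero_iff _).2 (key.congr hI ?_)
  rintro ε _ ⟨x, hx, rfl⟩
  -- What remains is that the subtracted term, `Δ` at the transformed corrected jet, vanishes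
  -- exactly on `Ξ_η(Ω)`.
  simp only [sub_eq_self]
  have hX : g.Xi (-η) (g.Xi η x) = x := g.Xi_neg (h x hx 0)
  rw [hX]
  refine g.eq_zero_of_classical_symmetry hsymm Ω.isOpen hx ?_ (h x hx _) ?_
  · exact (hu.1 ε).sub (contDiff_const.mul
      ((GenSymm.contDiff_jetMonom κ).comp (contDiff_id.sub contDiff_const))).contDiffOn
  -- The slope `c` is needed along the whole line of jets. For `κ = 0` the value `u` itself runs
  -- over the line, which stays over `M` because `g_η` is defined on all of `Ω × ℝ`.
  · rw [GenSymm.jet_sub_smul_jetMonom κ Ω.isOpen (hu.1 ε) hx, GenSymm.sub_smul_eq_of_fderiv_eq hΔc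
      fun t => hκ x _ (g.mem_of_dom (h x hx _))]
    field_simp
    simp
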